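/- Let $M$ be a complex manifold (finite-dimensional, Hausdorff, second countable). Let $PSH^{cb}(M)$ be the set of plurisubharmonic functions $u:M\to[-\infty,\infty)$ that are bounded above and continuous (as maps into $[-\infty,\infty)$). Let $\mathbf c(M)$ (the core of $M$) be the set of all $w\in M$ such that no function of $PSH^{cb}(M)$ is smooth and strictly plurisubharmonic near $w$. For $w_0\in M$ let $$A^{cb}_e(w_0)=\{w\in M:\ u(w)=u(w_0)\text{ for all }u\in PSH^{cb}(M)\}.$$ A closed set $X\subset M$ has the local maximum property if $X$ has no isolated points and every $z_0\in X$ has an open neighbourhood $V$ in $M$ with compact closure such that, for every open set $U$ with $z_0\in U$ whose closure is compact and contained in $V$ and for which $X\cap\partial U\neq\emptyset$, and for every plurisubharmonic function $u$ on $V$, $$\sup_{X\cap\overline U}u\le\sup_{X\cap\partial U}u .$$ Theorem. If $w_0\in\mathbf c(M)$, then $A^{cb}_e(w_0)$ is closed and has the local maximum property. -/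

import Mathlib

open scoped Manifold ContDiff Topology

noncomputable section

/-- The mean value `(1/2π) ∫ v(a + r e^{iθ}) dθ ∈ [-∞, ∞)` of a function `v` that is
measurable and bounded above on the circle of center `a` and radius `r`. By monotone convergence
this integral is the infimum, over `m`, of the integrals of the bounded functions `max v m`. -/
def circleMean (v : ℂ → EReal) (a : ℂ) (r : ℝ) : EReal :=
  ⨅ m : ℝ, ((Real.circleAverage (fun ζ => (max (v ζ) (m : EReal)).toReal) a r : ℝ) : EReal)

/-- `v` is a subharmonic function on the open set `D ⊆ ℂ`: it is upper semicontinuous with values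
in `[-∞, ∞)` and satisfies the sub-mean value inequality on all closed discs in `D`. As usual for
the definition through discs, the function `-∞` is admitted. -/
structure SubharmonicOn (v : ℂ → EReal) (D : Set ℂ) : Prop where
  usc : UpperSemicontinuousOn v D
  lt_top : ∀ z ∈ D, v z < ⊤
  le_circleMean : ∀ (a : ℂ) (r : ℝ), 0 < r → Metric.closedBall a r ⊆ D → v a ≤ circleMean v a r

section Manifold

variable (E : Type*) [NormedAddCommGroup E] [NormedSpace ℂ E]
  {M : Type*} [TopologicalSpace M] [ChartedSpace E M]

/-- `u` is plurisubharmonic on the open subset `V` of the complex manifold `M` (modelled on `E`):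
`u` is upper semicontinuous on `V` with values in `[-∞, ∞)`, and `u ∘ f` is subharmonic for every
holomorphic map `f` from an open subset of `ℂ` to `V`. The values of `u` outside `V` are
irrelevant. -/
structure PlurisubharmonicOn (u : M → EReal) (V : Set M) : Prop where
  usc : UpperSemicontinuousOn u V
  lt_top : ∀ x ∈ V, u x < ⊤
  subharmonicOn_comp : ∀ (f : ℂ → M) (D : Set ℂ), IsOpen D →
    MDifferentiableOn 𝓘(ℂ, ℂ) 𝓘(ℂ, E) f D → Set.MapsTo f D V → SubharmonicOn (u ∘ f) D

variable (M) in
/-- `PSH^{cb}(M)`: the plurisubharmonic functions on `M` that are continuous (as functions with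
values in `[-∞, ∞)`) and bounded above. -/
def PSHcb : Set (M → EReal) :=
  {u | PlurisubharmonicOn E u Set.univ ∧ Continuous u ∧ ∃ C : ℝ, ∀ x, u x ≤ (C : EReal)}

variable {E} in
/-- The Levi form `∑ⱼₖ (∂²g / ∂zⱼ ∂z̄ₖ)(z) vⱼ v̄ₖ` of a real function `g` that is `C²` near `z`,
written through the real second derivative as `(D²g(z)(v, v) + D²g(z)(iv, iv)) / 4`. -/
def leviForm (g : E → ℝ) (z v : E) : ℝ :=
  (fderiv ℝ (fderiv ℝ g) z v v +
    fderiv ℝ (fderiv ℝ g) z (Complex.I • v) (Complex.I • v)) / 4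

/-- `u` is (finite,) smooth and strictly plurisubharmonic near `w`: in a holomorphic chart around
`w` it is, on a neighbourhood of `w`, a real `C^∞` function with positive definite Levi form. -/
def SmoothStrictlyPSHNear (u : M → EReal) (w : M) : Prop :=
  (∀ᶠ x in 𝓝 w, u x ≠ ⊥ ∧ u x ≠ ⊤) ∧
  ∀ᶠ z in 𝓝 (chartAt E w w),
    ContDiffAt ℝ ∞ (fun y => (u ((chartAt E w).symm y)).toReal) z ∧
    ∀ v : E, v ≠ 0 → 0 < leviForm (fun y => (u ((chartAt E w).symm y)).toReal) z v

variable (M) in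
/-- The core `c(M)`: the points near which every function of `PSH^{cb}(M)` fails to be smooth and
strictly plurisubharmonic. -/
def core : Set M :=
  {w | ∀ u ∈ PSHcb E M, ¬ SmoothStrictlyPSHNear E u w}

/-- The set `A^{cb}_e(w₀)` of points at which every function of `PSH^{cb}(M)` takes the same value
as at `w₀`. -/
def Acbe (w₀ : M) : Set M :=
  {w | ∀ u ∈ PSHcb E M, u w = u w₀}

/-- The local maximum property of a subset `X` of the complex manifold `M`. `Perfect X` says that
`X` is closed and has no isolated points; the suprema are taken in `[-∞, ∞]`. -/
def HasLocalMaximumProperty (X : Set M) : Prop :=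
  Perfect X ∧
  ∀ z₀ ∈ X, ∃ V : Set M, IsOpen V ∧ z₀ ∈ V ∧ IsCompact (closure V) ∧
    ∀ U : Set M, IsOpen U → z₀ ∈ U → IsCompact (closure U) → closure U ⊆ V →
      (X ∩ frontier U).Nonempty →
      ∀ u : M → EReal, PlurisubharmonicOn E u V →
        (⨆ x ∈ X ∩ closure U, u x) ≤ ⨆ x ∈ X ∩ frontier U, u x

end Manifold

end

/-! Write A for `Acbe E w₀` and call "the class" the real-valued, continuous, bounded above
plurisubharmonic functions. Truncation from below shows that the class already determines A
(`mem_Acbe_iff`).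

Everything rests on one peak argument, `Acbe_subset_of_peak`. Let u be continuous and
plurisubharmonic near the closure of U, positive at a point z₁ of A ∩ U and negative on A ∩ ∂U. By
compactness of ∂U there are h, v in the class, vanishing at w₀ and hence on A, with u + h < v on ∂U:
h pushes u below 0 wherever no function of the class vanishing at w₀ is positive, and v dominates on
the rest. Gluing max(u + h, v) on U to v outside gives w in the class with w(z₁) > 0 and w = 0 on A
\ U. As w is constant on A, this forces A ⊆ U; moreover w = u + h near z₁.

Maximum principle: a plurisubharmonic function violating it is replaced by a larger continuous one,
a sup-convolution in a chart (`PlurisubharmonicOn.exists_isPshAt_ge`). After subtraction of a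
constant the peak argument gives A ⊆ U, against A ∩ ∂U ≠ ∅. The core plays no role here.

No isolated points: if z₀ is isolated in A, the peak argument with u = q + 1, where q is the squared
Euclidean distance to z₀ in a chart, gives A = {z₀} = {w₀} and a function of the class equal to q +
1 + h near w₀. Here h need not be smooth. But q can be lowered near w₀ to a plurisubharmonic
function with value -2 at w₀ (`logDip`), which leaves room to glue in q plus a constant
(`notMem_core_of_eventuallyEq`). The result is smooth and strictly plurisubharmonic near w₀, so w₀
is not in the core. -/

noncomputable section

/-! ### Circle averages and the sub-mean value property in the plane. -/

/-- The real part of a trigonometric polynomial is, on the unit circle, the real part of an entire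
function. -/
theorem exists_entire_re_eq_of_mem_span_fourier {g : C(AddCircle (2 * Real.pi), ℂ)}
    (hg : g ∈ Submodule.span ℂ (Set.range (@fourier (2 * Real.pi)))) :
    ∀ c : ℂ, ∃ P : ℂ → ℂ, Differentiable ℂ P ∧
      ∀ θ : AddCircle (2 * Real.pi), (c * g θ).re = (P (AddCircle.toCircle θ)).re := by
  induction hg using Submodule.span_induction with
  | mem x hx =>
    obtain ⟨n, rfl⟩ := hx
    intro c
    obtain ⟨m, rfl | rfl⟩ := n.eq_nat_or_neg
    · refine ⟨fun z => c * z ^ m, by fun_prop, fun θ => ?_⟩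
      simp [fourier_apply, AddCircle.toCircle_nsmul]
    -- Conjugation does not change the real part and turns the negative power on the unit circle
    -- into a positive one.
    · refine ⟨fun z => (starRingEnd ℂ c) * z ^ m, by fun_prop, fun θ => ?_⟩
      rw [fourier_neg, ← Complex.conj_re]
      simp [fourier_apply, AddCircle.toCircle_nsmul]
  | zero => exact fun c => ⟨fun _ => 0, by fun_prop, by simp⟩
  | add x y _ _ hx hy =>
    intro c
    obtain ⟨P, hP, hP'⟩ := hx c
    obtain ⟨Q, hQ, hQ'⟩ := hy c
    refine ⟨fun z => P z + Q z, hP.add hQ, fun θ => ?_⟩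
    rw [ContinuousMap.add_apply, mul_add, Complex.add_re, hP', hQ', Complex.add_re]
  | smul b x _ hx =>
    intro c
    -- The real part of b * x is not determined by that of x; the arbitrary factor c in the
    -- induction hypothesis absorbs b.
    obtain ⟨P, hP, hP'⟩ := hx (c * b)
    refine ⟨P, hP, fun θ => ?_⟩
    rw [← hP', ContinuousMap.smul_apply, smul_eq_mul, mul_assoc]

/-- A continuous function on a circle is uniformly approximated by real parts of entire
functions. -/
theorem exists_entire_re_approx {v : ℂ → ℝ} {a : ℂ} {R : ℝ} (hR : 0 < R)
    (hv : ContinuousOn v (Metric.sphere a R)) {ε : ℝ} (hε : 0 < ε) :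
    ∃ P : ℂ → ℂ, Differentiable ℂ P ∧ ∀ z ∈ Metric.sphere a R, |v z - (P z).re| ≤ ε := by
  have : Fact (0 < 2 * Real.pi) := ⟨Real.two_pi_pos⟩
  have hmem : ∀ θ : AddCircle (2 * Real.pi),
      a + R * (AddCircle.toCircle θ : ℂ) ∈ Metric.sphere a R := fun θ => by
    have h1 : ‖(AddCircle.toCircle θ : ℂ)‖ = 1 := Circle.norm_coe _
    rw [mem_sphere_iff_norm, add_sub_cancel_left, norm_mul, h1, mul_one, Complex.norm_real,
      Real.norm_of_nonneg hR.le]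
  let G : C(AddCircle (2 * Real.pi), ℂ) :=
    ⟨fun θ => (v (a + R * (AddCircle.toCircle θ : ℂ)) : ℂ), by
      refine Complex.continuous_ofReal.comp (hv.comp_continuous ?_ hmem)
      have := AddCircle.continuous_toCircle (T := 2 * Real.pi)
      fun_prop⟩
  have hG : G ∈ (Submodule.span ℂ (Set.range (@fourier (2 * Real.pi)))).topologicalClosure := by
    rw [span_fourier_closure_eq_top]; trivial
  rw [← SetLike.mem_coe, Submodule.topologicalClosure_coe, Metric.mem_closure_iff] at hG
  obtain ⟨g, hg, hgG⟩ := hG ε hε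
  obtain ⟨P, hP, hP'⟩ := exists_entire_re_eq_of_mem_span_fourier hg 1
  refine ⟨fun z => P ((z - a) / R), by fun_prop, fun z hz => ?_⟩
  rw [← abs_of_pos hR, ← range_circleMap] at hz
  obtain ⟨t, rfl⟩ := hz
  have ht : circleMap a R t = a + R * (AddCircle.toCircle (t : AddCircle (2 * Real.pi)) : ℂ) := by
    rw [AddCircle.toCircle_apply_mk, div_self Real.two_pi_pos.ne', one_mul, Circle.coe_exp,
      circleMap]
  have hR' : (R : ℂ) ≠ 0 := by exact_mod_cast hR.ne'
  have hdiv : ∀ ξ : ℂ, (a + R * ξ - a) / R = ξ := fun ξ => by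
    rw [add_sub_cancel_left, mul_div_cancel_left₀ _ hR']
  have hval : (P ((circleMap a R t - a) / R)).re = (g (t : AddCircle (2 * Real.pi))).re := by
    rw [ht, hdiv, ← hP', one_mul]
  beta_reduce
  rw [hval, ht]
  have h1 : ‖G t - g t‖ ≤ ε := by
    rw [← dist_eq_norm]
    exact (ContinuousMap.dist_apply_le_dist _).trans hgG.le
  have h2 := (Complex.abs_re_le_norm (G t - g t)).trans h1
  simpa [G] using h2

theorem circleAverage_re {P : ℂ → ℂ} {a : ℂ} {R : ℝ} (hR : 0 < R)
    (hP : ∀ z ∈ Metric.closedBall a R, DifferentiableAt ℂ P z) :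
    Real.circleAverage (fun z => (P z).re) a R = (P a).re := by
  have hd : DifferentiableOn ℂ P (closure (Metric.ball a |R|)) := fun z hz =>
    (hP z (Metric.closure_ball_subset_closedBall
      (by rwa [abs_of_pos hR] at hz))).differentiableWithinAt
  have h1 := hd.diffContOnCl.circleAverage
  have h2 : CircleIntegrable P a R := ContinuousOn.circleIntegrable hR.le fun z hz =>
    (hP z (Metric.sphere_subset_closedBall hz)).continuousAt.continuousWithinAt
  have := Complex.reCLM.circleAverage_comp_comm h2
  rw [h1] at this
  exact this

theorem Filter.Eventually.forall_closedBall {p : ℂ → Prop} {a : ℂ} (h : ∀ᶠ z in 𝓝 a, p z) :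
    ∀ᶠ r in 𝓝[>] (0 : ℝ), ∀ z ∈ Metric.closedBall a r, p z := by
  obtain ⟨ε, hε, hp⟩ := Metric.eventually_nhds_iff_ball.1 h
  filter_upwards [Ioo_mem_nhdsGT hε] with r hr z hz
  exact hp z (Metric.closedBall_subset_ball hr.2 hz)

/-- On the circle, ‖z - a‖² equals ‖b - a‖² + r² plus the real part of a linear function vanishing
at b, which has mean 0. -/
theorem circleAverage_normSq_sub {a b : ℂ} {r : ℝ} (hr : 0 < r) :
    Real.circleAverage (fun z => ‖z - a‖ ^ 2) b r = ‖b - a‖ ^ 2 + r ^ 2 := by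
  have key : Set.EqOn (fun z => ‖z - a‖ ^ 2)
      (fun z => (((2 * starRingEnd ℂ (b - a)) * (z - b) + (‖b - a‖ ^ 2 + r ^ 2 : ℝ) : ℂ)).re)
      (Metric.sphere b |r|) := by
    intro z hz
    rw [abs_of_pos hr, mem_sphere_iff_norm] at hz
    have h0 : ‖z - a‖ ^ 2 = ‖(z - b) + (b - a)‖ ^ 2 := by congr 2; ring
    simp only [h0]
    rw [← hz, ← Complex.normSq_eq_norm_sq, ← Complex.normSq_eq_norm_sq, ← Complex.normSq_eq_norm_sq]
    simp [Complex.normSq_apply]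
    ring
  rw [Real.circleAverage_congr_sphere key, circleAverage_re hr (fun z _ => by fun_prop)]
  rw [sub_self, mul_zero, zero_add, Complex.ofReal_re]

/-- Maximum principle on a disc for continuous functions with the local sub-mean value
property. -/
theorem le_of_local_submean {s : ℂ → ℝ} {a : ℂ} {R C : ℝ} (hR : 0 < R)
    (hs : ContinuousOn s (Metric.closedBall a R))
    (hm : ∀ b ∈ Metric.ball a R, ∀ᶠ r in 𝓝[>] (0 : ℝ), s b ≤ Real.circleAverage s b r)
    (hC : ∀ z ∈ Metric.sphere a R, s z ≤ C) : s a ≤ C := by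
  have key : ∀ δ : ℝ, 0 < δ → s a ≤ C + δ * R ^ 2 := by
    intro δ hδ
    -- The perturbation makes the sub-mean value inequality strict by δ r², so that t has no
    -- interior maximum; then δ tends to 0.
    set t : ℂ → ℝ := fun z => s z + δ * ‖z - a‖ ^ 2 with ht
    have htc : ContinuousOn t (Metric.closedBall a R) := by
      refine hs.add (Continuous.continuousOn (by fun_prop))
    obtain ⟨b, hb, hbm⟩ := (isCompact_closedBall a R).exists_isMaxOn
      ⟨a, Metric.mem_closedBall_self hR.le⟩ htc
    have hab : t a ≤ t b := hbm (Metric.mem_closedBall_self hR.le)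
    have hta : t a = s a := by simp [ht]
    rcases (Metric.mem_closedBall.1 hb).lt_or_eq with hlt | heq
    · exfalso
      have hin : ∀ᶠ z in 𝓝 b, z ∈ Metric.ball a R := Metric.isOpen_ball.mem_nhds hlt
      obtain ⟨r, ⟨h1, h2⟩, h3⟩ := ((hm b hlt).and hin.forall_closedBall).and
        self_mem_nhdsWithin |>.exists
      have hr : 0 < r := h3
      have hsub : Metric.sphere b r ⊆ Metric.closedBall a R := fun z hz =>
        Metric.ball_subset_closedBall (h2 z (Metric.sphere_subset_closedBall hz))
      have hsi : CircleIntegrable s b r := (hs.mono hsub).circleIntegrable hr.le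
      have hqi : CircleIntegrable (fun z => δ * ‖z - a‖ ^ 2) b r :=
        ContinuousOn.circleIntegrable hr.le (Continuous.continuousOn (by fun_prop))
      have h4 : Real.circleAverage t b r =
          Real.circleAverage s b r + δ * (‖b - a‖ ^ 2 + r ^ 2) := by
        rw [ht, Real.circleAverage_fun_add hsi hqi]
        congr 1
        have := Real.circleAverage_fun_smul (a := δ)
          (f := fun z : ℂ => ‖z - a‖ ^ 2) (c := b) (R := r)
        simp only [smul_eq_mul] at this
        rw [this, circleAverage_normSq_sub hr]
      have h5 : Real.circleAverage t b r ≤ t b :=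
        Real.circleAverage_mono_on_of_le_circle ((htc.mono hsub).circleIntegrable hr.le)
          (fun z hz => hbm (hsub (by rwa [abs_of_pos hr] at hz)))
      have h6 : t b = s b + δ * ‖b - a‖ ^ 2 := rfl
      have : 0 < δ * r ^ 2 := by positivity
      nlinarith
    · have h1 : t b = s b + δ * R ^ 2 := by
        simp only [ht]; rw [← dist_eq_norm, heq]
      have h2 := hC b heq
      linarith
  by_contra! h
  have h1 := key ((s a - C) / (2 * R ^ 2)) (by have : 0 < s a - C := by linarith
                                               positivity)
  have h2 : (s a - C) / (2 * R ^ 2) * R ^ 2 = (s a - C) / 2 := by field_simp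
  linarith

/-- For continuous functions the local sub-mean value property implies the one on all discs. -/
theorem le_circleAverage_of_local {v : ℂ → ℝ} {a : ℂ} {R : ℝ} (hR : 0 < R)
    (hv : ContinuousOn v (Metric.closedBall a R))
    (hm : ∀ b ∈ Metric.ball a R, ∀ᶠ r in 𝓝[>] (0 : ℝ), v b ≤ Real.circleAverage v b r) :
    v a ≤ Real.circleAverage v a R := by
  refine le_of_forall_pos_le_add fun ε hε => ?_
  have hvs := hv.mono (Metric.sphere_subset_closedBall (x := a) (ε := R))
  -- Re P replaces the Poisson integral: it is harmonic and within ε / 2 of v on the circle, so the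
  -- maximum principle applies to v - Re P.
  obtain ⟨P, hP, hPv⟩ := exists_entire_re_approx hR hvs (half_pos hε)
  have hPc : Continuous fun z => (P z).re := Complex.continuous_re.comp hP.continuous
  have h1 : v a - (P a).re ≤ ε / 2 := by
    refine le_of_local_submean (s := fun z => v z - (P z).re) hR (hv.sub hPc.continuousOn)
      (fun b hb => ?_) (fun z hz => (abs_le.1 (hPv z hz)).2)
    have hin : ∀ᶠ z in 𝓝 b, z ∈ Metric.ball a R := Metric.isOpen_ball.mem_nhds hb
    filter_upwards [hm b hb, hin.forall_closedBall, self_mem_nhdsWithin] with r h1 h2 h3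
    have hr : 0 < r := h3
    have hvi : CircleIntegrable v b r := (hv.mono fun z hz =>
      Metric.ball_subset_closedBall (h2 z
        (Metric.sphere_subset_closedBall hz))).circleIntegrable hr.le
    rw [Real.circleAverage_fun_sub hvi (hPc.continuousOn.circleIntegrable hr.le),
      circleAverage_re hr fun z _ => hP z]
    linarith
  have h2 : Real.circleAverage (fun z => (P z).re) a R ≤
      Real.circleAverage (fun z => v z + ε / 2) a R := by
    refine Real.circleAverage_mono (hPc.continuousOn.circleIntegrable hR.le)
      ((hvs.add continuousOn_const).circleIntegrable hR.le) fun z hz => ?_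
    rw [abs_of_pos hR] at hz
    linarith [(abs_le.1 (hPv z hz)).1]
  rw [circleAverage_re hR fun z _ => hP z, Real.circleAverage_fun_add (hvs.circleIntegrable hR.le)
    (continuousOn_const.circleIntegrable hR.le), Real.circleAverage_const] at h2
  linarith

/-! ### Truncation from below and subharmonic functions with values in `EReal`. -/

/-- The real number `max x m`, for `x ∈ [-∞, ∞)`. -/
def truncBelow (m : ℝ) (x : EReal) : ℝ := (max x (m : EReal)).toReal

theorem coe_truncBelow {m : ℝ} {x : EReal} (hx : x < ⊤) :
    ((truncBelow m x : ℝ) : EReal) = max x m :=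
  EReal.coe_toReal (max_lt hx (EReal.coe_lt_top m)).ne
    (lt_of_lt_of_le (EReal.bot_lt_coe m) (le_max_right _ _)).ne'

theorem truncBelow_le_iff {m c : ℝ} {x : EReal} (hx : x < ⊤) :
    truncBelow m x ≤ c ↔ x ≤ c ∧ m ≤ c := by
  rw [← EReal.coe_le_coe_iff, coe_truncBelow hx, max_le_iff, EReal.coe_le_coe_iff]

theorem truncBelow_lt_iff {m c : ℝ} {x : EReal} (hx : x < ⊤) :
    truncBelow m x < c ↔ x < c ∧ m < c := by
  rw [← EReal.coe_lt_coe_iff, coe_truncBelow hx, max_lt_iff, EReal.coe_lt_coe_iff]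

theorem le_truncBelow {m : ℝ} {x : EReal} (hx : x < ⊤) : m ≤ truncBelow m x :=
  ((truncBelow_le_iff hx).1 le_rfl).2

theorem continuousOn_truncBelow (m : ℝ) : ContinuousOn (truncBelow m) {x | x < ⊤} := by
  refine EReal.continuousOn_toReal.comp (Continuous.continuousOn (by fun_prop)) fun x hx => ?_
  simp only [Set.mem_compl_iff, Set.mem_insert_iff, Set.mem_singleton_iff, not_or]
  exact ⟨(lt_of_lt_of_le (EReal.bot_lt_coe m) (le_max_right _ _)).ne',
    (max_lt hx (EReal.coe_lt_top m)).ne⟩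

theorem upperSemicontinuousOn_truncBelow {X : Type*} [TopologicalSpace X] {u : X → EReal}
    {V : Set X} (hu : UpperSemicontinuousOn u V) (ht : ∀ x ∈ V, u x < ⊤) (m : ℝ) :
    UpperSemicontinuousOn (fun x => truncBelow m (u x)) V := by
  intro x hx c hc
  rw [truncBelow_lt_iff (ht x hx)] at hc
  filter_upwards [hu x hx c hc.1, self_mem_nhdsWithin] with y hy hyV
  exact (truncBelow_lt_iff (ht y hyV)).2 ⟨hy, hc.2⟩

/-- Upper semicontinuity gives measurability and an upper bound on the circle; the truncation gives
the lower bound. -/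
theorem SubharmonicOn.circleIntegrable_truncBelow {v : ℂ → EReal} {D : Set ℂ}
    (hv : SubharmonicOn v D) {a : ℂ} {r : ℝ} (hr : 0 < r) (hD : Metric.closedBall a r ⊆ D)
    (m : ℝ) : CircleIntegrable (fun z => truncBelow m (v z)) a r := by
  have hsub : Metric.sphere a r ⊆ D := Metric.sphere_subset_closedBall.trans hD
  have hmap : ∀ θ : ℝ, circleMap a r θ ∈ Metric.sphere a r := fun θ =>
    circleMap_mem_sphere a hr.le θ
  have husc := (upperSemicontinuousOn_truncBelow hv.usc hv.lt_top m).mono hsub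
  have husc' : UpperSemicontinuous fun θ : ℝ => truncBelow m (v (circleMap a r θ)) := by
    rw [← upperSemicontinuousOn_univ_iff]
    exact UpperSemicontinuousOn.comp (f := fun z => truncBelow m (v z)) husc
      (continuous_circleMap a r).continuousOn
      (fun θ _ => hmap θ)
  obtain ⟨B, hB⟩ := husc.bddAbove_of_isCompact (isCompact_sphere a r)
  refine MeasureTheory.Measure.integrableOn_of_bounded (M := max |B| |m|) ?_ ?_ ?_
    |>.intervalIntegrable
  · exact isCompact_uIcc.measure_lt_top.ne
  · exact husc'.measurable.aestronglyMeasurable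
  · filter_upwards with θ
    rw [Real.norm_eq_abs]
    have h1 : truncBelow m (v (circleMap a r θ)) ≤ B := hB ⟨_, hmap θ, rfl⟩
    have h2 : m ≤ truncBelow m (v (circleMap a r θ)) :=
      le_truncBelow (hv.lt_top _ (hsub (hmap θ)))
    rw [max_comm]
    exact abs_le_max_abs_abs h2 h1

theorem SubharmonicOn.truncBelow_le {v : ℂ → EReal} {D : Set ℂ}
    (hv : SubharmonicOn v D) {a : ℂ} {r : ℝ} (hr : 0 < r) (hD : Metric.closedBall a r ⊆ D)
    (m : ℝ) : truncBelow m (v a) ≤ Real.circleAverage (fun z => truncBelow m (v z)) a r := by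
  have hi := hv.circleIntegrable_truncBelow hr hD m
  refine (truncBelow_le_iff (hv.lt_top a (hD (Metric.mem_closedBall_self hr.le)))).2 ⟨?_, ?_⟩
  · exact (hv.le_circleMean a r hr hD).trans (iInf_le _ m)
  · refine (Real.circleAverage_const m a r).symm.trans_le ?_
    refine Real.circleAverage_mono (circleIntegrable_const _ _ _) hi fun z hz => ?_
    rw [abs_of_pos hr] at hz
    exact le_truncBelow (hv.lt_top z (hD (Metric.sphere_subset_closedBall hz)))

/-- A continuous real function with the local sub-mean value property is subharmonic. -/
theorem subharmonicOn_coe {v : ℂ → ℝ} {D : Set ℂ} (hv : ContinuousOn v D)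
    (hm : ∀ b ∈ D, ∀ᶠ r in 𝓝[>] (0 : ℝ), v b ≤ Real.circleAverage v b r) :
    SubharmonicOn (fun z => (v z : EReal)) D where
  usc := (continuous_coe_real_ereal.comp_continuousOn hv).upperSemicontinuousOn
  lt_top := fun z _ => EReal.coe_lt_top _
  le_circleMean := by
    intro a r hr hD
    refine le_iInf fun m => ?_
    have hvs : ContinuousOn v (Metric.sphere a r) :=
      hv.mono (Metric.sphere_subset_closedBall.trans hD)
    have heq : (fun ζ => (max (v ζ : EReal) (m : EReal)).toReal) = fun ζ => max (v ζ) m := by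
      funext ζ
      rw [← Monotone.map_max EReal.coe_strictMono.monotone, EReal.toReal_coe]
    rw [heq, EReal.coe_le_coe_iff]
    refine (le_circleAverage_of_local hr (hv.mono hD)
      fun b hb => hm b (hD (Metric.ball_subset_closedBall hb))).trans ?_
    exact Real.circleAverage_mono (hvs.circleIntegrable hr.le)
      ((hvs.sup continuousOn_const).circleIntegrable hr.le) fun z _ => le_max_left _ _

/-! ### The pointwise sub-mean value property on a manifold. -/

section Manifold

variable (E : Type*) [NormedAddCommGroup E] [NormedSpace ℂ E]
  {M : Type*} [TopologicalSpace M] [ChartedSpace E M]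

/-- `g` is continuous near `x` and satisfies the sub-mean value inequality at `x` on the images of
small circles under germs of holomorphic discs through `x`. -/
structure IsPshAt (g : M → ℝ) (x : M) : Prop where
  eventually_continuousAt : ∀ᶠ y in 𝓝 x, ContinuousAt g y
  eventually_le_circleAverage : ∀ (f : ℂ → M) (a : ℂ), f a = x →
    (∀ᶠ z in 𝓝 a, MDifferentiableAt 𝓘(ℂ, ℂ) 𝓘(ℂ, E) f z) →
    ∀ᶠ r in 𝓝[>] (0 : ℝ), g x ≤ Real.circleAverage (g ∘ f) a r

variable {E}

theorem eventually_circleIntegrable {g : M → ℝ} {x : M} (hg : ∀ᶠ y in 𝓝 x, ContinuousAt g y)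
    {f : ℂ → M} {a : ℂ} (hfa : f a = x)
    (hf : ∀ᶠ z in 𝓝 a, MDifferentiableAt 𝓘(ℂ, ℂ) 𝓘(ℂ, E) f z) :
    ∀ᶠ r in 𝓝[>] (0 : ℝ), CircleIntegrable (g ∘ f) a r := by
  have h1 : ∀ᶠ z in 𝓝 a, ContinuousAt g (f z) := by
    have := hf.self_of_nhds.continuousAt
    rw [ContinuousAt, hfa] at this
    exact this.eventually hg
  filter_upwards [(h1.and hf).forall_closedBall, self_mem_nhdsWithin] with r hr hr0
  refine ContinuousOn.circleIntegrable (le_of_lt hr0) fun z hz => ?_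
  have h2 := hr z (Metric.sphere_subset_closedBall hz)
  exact (ContinuousAt.comp h2.1 h2.2.continuousAt).continuousWithinAt

namespace IsPshAt

variable {g g' : M → ℝ} {x : M}

theorem continuousAt (hg : IsPshAt E g x) : ContinuousAt g x :=
  hg.eventually_continuousAt.self_of_nhds

theorem congr (hg : IsPshAt E g x) (h : g =ᶠ[𝓝 x] g') : IsPshAt E g' x where
  eventually_continuousAt := by
    filter_upwards [hg.eventually_continuousAt, h.eventuallyEq_nhds] with y hy hy'
    exact hy.congr hy'
  eventually_le_circleAverage := by
    intro f a hfa hf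
    have h1 : ∀ᶠ z in 𝓝 a, g (f z) = g' (f z) := by
      have := hf.self_of_nhds.continuousAt
      rw [ContinuousAt, hfa] at this
      exact this.eventually h
    filter_upwards [hg.eventually_le_circleAverage f a hfa hf, h1.forall_closedBall,
      self_mem_nhdsWithin] with r hr hr' hr0
    rw [← h.self_of_nhds]
    refine hr.trans_eq (Real.circleAverage_congr_sphere fun z hz => ?_)
    rw [abs_of_pos hr0] at hz
    exact hr' z (Metric.sphere_subset_closedBall hz)

/-- A continuous function which is touched from below by a plurisubharmonic one. -/
theorem of_le (hg : IsPshAt E g x) (hc : ∀ᶠ y in 𝓝 x, ContinuousAt g' y)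
    (hle : ∀ᶠ y in 𝓝 x, g y ≤ g' y) (heq : g x = g' x) : IsPshAt E g' x where
  eventually_continuousAt := hc
  eventually_le_circleAverage := by
    intro f a hfa hf
    have h1 : ∀ᶠ z in 𝓝 a, g (f z) ≤ g' (f z) := by
      have := hf.self_of_nhds.continuousAt
      rw [ContinuousAt, hfa] at this
      exact this.eventually hle
    filter_upwards [hg.eventually_le_circleAverage f a hfa hf, h1.forall_closedBall,
      self_mem_nhdsWithin, eventually_circleIntegrable hg.eventually_continuousAt hfa hf,
      eventually_circleIntegrable hc hfa hf] with r hr hr' hr0 hi hi'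
    rw [← heq]
    refine hr.trans (Real.circleAverage_mono hi hi' fun z hz => ?_)
    rw [abs_of_pos hr0] at hz
    exact hr' z (Metric.sphere_subset_closedBall hz)

theorem max (hg : IsPshAt E g x) (hg' : IsPshAt E g' x) :
    IsPshAt E (fun y => max (g y) (g' y)) x := by
  have hc : ∀ᶠ y in 𝓝 x, ContinuousAt (fun y => Max.max (g y) (g' y)) y := by
    filter_upwards [hg.eventually_continuousAt, hg'.eventually_continuousAt] with y h1 h2
    exact h1.sup h2
  rcases le_total (g x) (g' x) with h | h
  · exact hg'.of_le hc (Filter.Eventually.of_forall fun y => le_max_right _ _) (by simp [h])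
  · exact hg.of_le hc (Filter.Eventually.of_forall fun y => le_max_left _ _) (by simp [h])

theorem add (hg : IsPshAt E g x) (hg' : IsPshAt E g' x) :
    IsPshAt E (fun y => g y + g' y) x where
  eventually_continuousAt := by
    filter_upwards [hg.eventually_continuousAt, hg'.eventually_continuousAt] with y h1 h2
    exact h1.add h2
  eventually_le_circleAverage := by
    intro f a hfa hf
    filter_upwards [hg.eventually_le_circleAverage f a hfa hf,
      hg'.eventually_le_circleAverage f a hfa hf,
      eventually_circleIntegrable hg.eventually_continuousAt hfa hf,
      eventually_circleIntegrable hg'.eventually_continuousAt hfa hf] with r h1 h2 h3 h4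
    exact (add_le_add h1 h2).trans_eq (Real.circleAverage_add h3 h4).symm

theorem const_mul (hg : IsPshAt E g x) {c : ℝ} (hc : 0 ≤ c) :
    IsPshAt E (fun y => c * g y) x where
  eventually_continuousAt := by
    filter_upwards [hg.eventually_continuousAt] with y h1
    exact continuousAt_const.mul h1
  eventually_le_circleAverage := by
    intro f a hfa hf
    filter_upwards [hg.eventually_le_circleAverage f a hfa hf] with r h1
    exact (mul_le_mul_of_nonneg_left h1 hc).trans_eq
      (Real.circleAverage_fun_smul (a := c) (f := g ∘ f)).symm

theorem re_of_mdifferentiableAt {P : M → ℂ}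
    (hP : ∀ᶠ y in 𝓝 x, MDifferentiableAt 𝓘(ℂ, E) 𝓘(ℂ, ℂ) P y) :
    IsPshAt E (fun y => (P y).re) x where
  eventually_continuousAt := by
    filter_upwards [hP] with y hy
    exact Complex.continuous_re.continuousAt.comp hy.continuousAt
  eventually_le_circleAverage := by
    intro f a hfa hf
    have h1 : ∀ᶠ z in 𝓝 a, MDifferentiableAt 𝓘(ℂ, E) 𝓘(ℂ, ℂ) P (f z) := by
      have := hf.self_of_nhds.continuousAt
      rw [ContinuousAt, hfa] at this
      exact this.eventually hP
    filter_upwards [(h1.and hf).forall_closedBall, self_mem_nhdsWithin] with r hr hr0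
    have h2 := circleAverage_re (P := P ∘ f) (a := a) hr0 fun z hz => by
      obtain ⟨h3, h4⟩ := hr z hz
      exact (h3.comp z h4).differentiableAt
    exact (h2.trans (by simp [hfa])).ge

theorem const (c : ℝ) (x : M) : IsPshAt E (fun _ : M => c) x := by
  simpa using re_of_mdifferentiableAt (E := E) (x := x) (P := fun _ => (c : ℂ))
    (Filter.Eventually.of_forall fun y => mdifferentiableAt_const)

end IsPshAt

/-- A plurisubharmonic function, truncated from below, satisfies the sub-mean value inequality on
small holomorphic discs. -/
theorem PlurisubharmonicOn.eventually_truncBelow {u : M → EReal} {V : Set M} (hV : IsOpen V)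
    (hu : PlurisubharmonicOn E u V) (m : ℝ) {f : ℂ → M} {a : ℂ} (hfa : f a ∈ V)
    (hf : ∀ᶠ z in 𝓝 a, MDifferentiableAt 𝓘(ℂ, ℂ) 𝓘(ℂ, E) f z) :
    ∀ᶠ r in 𝓝[>] (0 : ℝ),
      CircleIntegrable (fun z => truncBelow m (u (f z))) a r ∧
      truncBelow m (u (f a)) ≤ Real.circleAverage (fun z => truncBelow m (u (f z))) a r := by
  have h1 : ∀ᶠ z in 𝓝 a, f z ∈ V := hf.self_of_nhds.continuousAt.eventually (hV.mem_nhds hfa)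
  obtain ⟨ε, hε, hp⟩ := Metric.eventually_nhds_iff_ball.1 (hf.and h1)
  have hsub := hu.subharmonicOn_comp f (Metric.ball a ε) Metric.isOpen_ball
    (fun z hz => (hp z hz).1.mdifferentiableWithinAt) (fun z hz => (hp z hz).2)
  filter_upwards [Ioo_mem_nhdsGT hε] with r hr
  have h2 := Metric.closedBall_subset_ball (x := a) hr.2
  exact ⟨hsub.circleIntegrable_truncBelow hr.1 h2 m, hsub.truncBelow_le hr.1 h2 m⟩

/-! ### The class of bounded above plurisubharmonic functions, and gluing. -/

variable (E) in
/-- The real-valued, continuous, bounded above plurisubharmonic functions. -/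
structure IsBoundedPsh (g : M → ℝ) : Prop where
  isPshAt : ∀ x, IsPshAt E g x
  bddAbove : ∃ C, ∀ x, g x ≤ C

namespace IsBoundedPsh

variable {g g' : M → ℝ}

theorem continuous (hg : IsBoundedPsh E g) : Continuous g :=
  continuous_iff_continuousAt.2 fun x => (hg.isPshAt x).continuousAt

theorem coe_mem_PSHcb (hg : IsBoundedPsh E g) : (fun x => (g x : EReal)) ∈ PSHcb E M := by
  have hc : Continuous fun x => (g x : EReal) := continuous_coe_real_ereal.comp hg.continuous
  refine ⟨⟨hc.upperSemicontinuous.upperSemicontinuousOn _, fun x _ => EReal.coe_lt_top _, ?_⟩, hc,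
    hg.bddAbove.imp fun C hC x => EReal.coe_le_coe (hC x)⟩
  intro f D hD hf _
  refine subharmonicOn_coe (hg.continuous.comp_continuousOn hf.continuousOn) fun b hb => ?_
  refine (hg.isPshAt (f b)).eventually_le_circleAverage f b rfl ?_
  filter_upwards [hD.mem_nhds hb] with z hz
  exact (hf z hz).mdifferentiableAt (hD.mem_nhds hz)

theorem add (hg : IsBoundedPsh E g) (hg' : IsBoundedPsh E g') :
    IsBoundedPsh E fun x => g x + g' x := by
  obtain ⟨C, hC⟩ := hg.bddAbove
  obtain ⟨C', hC'⟩ := hg'.bddAbove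
  exact ⟨fun x => (hg.isPshAt x).add (hg'.isPshAt x), C + C', fun x => add_le_add (hC x) (hC' x)⟩

theorem max (hg : IsBoundedPsh E g) (hg' : IsBoundedPsh E g') :
    IsBoundedPsh E fun x => max (g x) (g' x) := by
  obtain ⟨C, hC⟩ := hg.bddAbove
  obtain ⟨C', hC'⟩ := hg'.bddAbove
  exact ⟨fun x => (hg.isPshAt x).max (hg'.isPshAt x), Max.max C C',
    fun x => max_le_max (hC x) (hC' x)⟩

theorem const_mul (hg : IsBoundedPsh E g) {c : ℝ} (hc : 0 ≤ c) :
    IsBoundedPsh E fun x => c * g x := by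
  obtain ⟨C, hC⟩ := hg.bddAbove
  exact ⟨fun x => (hg.isPshAt x).const_mul hc, c * C,
    fun x => mul_le_mul_of_nonneg_left (hC x) hc⟩

theorem const (c : ℝ) : IsBoundedPsh E fun _ : M => c :=
  ⟨fun x => IsPshAt.const c x, c, fun _ => le_rfl⟩

theorem sub_const (hg : IsBoundedPsh E g) (c : ℝ) : IsBoundedPsh E fun x => g x - c := by
  simpa only [sub_eq_add_neg] using hg.add (const (-c))

theorem truncBelow {u : M → EReal} (hu : u ∈ PSHcb E M) (m : ℝ) :
    IsBoundedPsh E fun x => truncBelow m (u x) := by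
  obtain ⟨hpsh, hc, C, hC⟩ := hu
  have htop : ∀ x, u x < ⊤ := fun x => hpsh.lt_top x trivial
  refine ⟨fun x => ⟨?_, ?_⟩, Max.max C m, fun x =>
    (truncBelow_le_iff (htop x)).2 ⟨(hC x).trans (EReal.coe_le_coe (le_max_left _ _)),
      le_max_right _ _⟩⟩
  · refine Filter.Eventually.of_forall fun y => Continuous.continuousAt ?_
    exact (continuousOn_truncBelow m).comp_continuous hc htop
  · rintro f a rfl hf
    filter_upwards [hpsh.eventually_truncBelow isOpen_univ m (Set.mem_univ _) hf] with r hr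
    exact hr.2

end IsBoundedPsh

/-- If u x < u y, truncation at a real level strictly between the two values still separates x from
y, even when u x is `⊥`. -/
theorem mem_Acbe_iff {w₀ w : M} :
    w ∈ Acbe E w₀ ↔ ∀ g : M → ℝ, IsBoundedPsh E g → g w = g w₀ := by
  constructor
  · intro hw g hg
    simpa using hw _ hg.coe_mem_PSHcb
  · intro h u hu
    have htop : ∀ x, u x < ⊤ := fun x => hu.1.lt_top x trivial
    have key : ∀ x y, (∀ m, truncBelow m (u x) = truncBelow m (u y)) → ¬ u x < u y := by
      intro x y hxy hlt
      obtain ⟨m, hm1, hm2⟩ := EReal.lt_iff_exists_real_btwn.1 hlt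
      have h1 := (truncBelow_le_iff (m := m) (c := m) (htop x)).2 ⟨hm1.le, le_rfl⟩
      rw [hxy m, truncBelow_le_iff (htop y)] at h1
      exact absurd h1.1 (not_le.2 hm2)
    have h' : ∀ m, truncBelow m (u w) = truncBelow m (u w₀) := fun m =>
      h _ (IsBoundedPsh.truncBelow hu m)
    exact le_antisymm (not_lt.1 (key w₀ w fun m => (h' m).symm)) (not_lt.1 (key w w₀ h'))

/-- Gluing: a plurisubharmonic function on a neighbourhood of `closure U` that is smaller than `v`
on `frontier U` is extended by `v`. -/
theorem IsBoundedPsh.glue {U : Set M} (hU : IsOpen U) (hUc : IsCompact (closure U)) {u v : M → ℝ}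
    (hu : ∀ x ∈ closure U, IsPshAt E u x) (hv : IsBoundedPsh E v)
    (huv : ∀ x ∈ frontier U, u x < v x) :
    ∃ w : M → ℝ, IsBoundedPsh E w ∧ (∀ x ∈ U, w x = Max.max (u x) (v x)) ∧ ∀ x ∉ U, w x = v x := by
  classical
  refine ⟨fun x => if x ∈ U then Max.max (u x) (v x) else v x, ⟨fun x => ?_, ?_⟩,
    fun x hx => if_pos hx, fun x hx => if_neg hx⟩
  · by_cases hxU : x ∈ U
    · refine ((hu x (subset_closure hxU)).max (hv.isPshAt x)).congr ?_
      filter_upwards [hU.mem_nhds hxU] with y hy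
      exact (if_pos hy).symm
    · by_cases hxc : x ∈ closure U
      · refine (hv.isPshAt x).congr ?_
        -- The strict inequality persists near a frontier point, so both branches equal v there.
        have hlt := huv x (by rw [hU.frontier_eq]; exact ⟨hxc, hxU⟩)
        filter_upwards [(hu x hxc).continuousAt.eventually_lt (hv.isPshAt x).continuousAt hlt]
          with y hy
        split_ifs
        · exact (max_eq_right hy.le).symm
        · rfl
      · refine (hv.isPshAt x).congr ?_
        filter_upwards [isClosed_closure.isOpen_compl.mem_nhds hxc] with y hy
        exact (if_neg fun h => hy (subset_closure h)).symm
  · obtain ⟨C, hC⟩ := hv.bddAbove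
    obtain ⟨C', hC'⟩ := hUc.bddAbove_image (f := u) fun x hx =>
      (hu x hx).continuousAt.continuousWithinAt
    refine ⟨Max.max C' C, fun x => ?_⟩
    split_ifs with h
    · exact max_le_max (hC' ⟨x, subset_closure h, rfl⟩) (hC x)
    · exact (hC x).trans (le_max_right _ _)

end Manifold

/-! ### The peak argument for `Acbe`. -/

section Manifold

variable {E : Type*} [NormedAddCommGroup E] [NormedSpace ℂ E]
  {M : Type*} [TopologicalSpace M] [ChartedSpace E M]

theorem isClosed_Acbe (w₀ : M) : IsClosed (Acbe E w₀) := by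
  have : Acbe E w₀ = ⋂ u ∈ PSHcb E M, {w | u w = u w₀} := by
    ext w; simp [Acbe]
  rw [this]
  exact isClosed_biInter fun u hu => isClosed_eq hu.2.1 continuous_const

/-- A plurisubharmonic function near `closure U` that is negative on `Acbe E w₀ ∩ frontier U` is
made negative, by adding a function of the class vanishing on `Acbe E w₀`, at all points of
`frontier U` at which no function of the class exceeds its value at `w₀`. -/
theorem exists_add_neg {w₀ : M} {K : Set M} (hK : IsCompact K) {u : M → ℝ}
    (hu : ∀ x ∈ K, ContinuousAt u x) (hneg : ∀ x ∈ Acbe E w₀ ∩ K, u x < 0) :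
    ∃ h : M → ℝ, IsBoundedPsh E h ∧ h w₀ = 0 ∧
      ∀ x ∈ K, (∀ g : M → ℝ, IsBoundedPsh E g → g w₀ = 0 → g x ≤ 0) → u x + h x < 0 := by
  refine hK.induction_on (p := fun s => ∃ h : M → ℝ, IsBoundedPsh E h ∧ h w₀ = 0 ∧ ∀ x ∈ s,
    (∀ g : M → ℝ, IsBoundedPsh E g → g w₀ = 0 → g x ≤ 0) → u x + h x < 0) ?_ ?_ ?_ ?_
  · exact ⟨fun _ => 0, IsBoundedPsh.const 0, rfl, by simp⟩
  · rintro s t hst ⟨h, h1, h2, h3⟩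
    exact ⟨h, h1, h2, fun x hx => h3 x (hst hx)⟩
  · rintro s t ⟨h, h1, h2, h3⟩ ⟨k, k1, k2, k3⟩
    -- At the points concerned every function of the class vanishing at w₀ is nonpositive, so the
    -- extra summand does no harm.
    refine ⟨fun x => h x + k x, h1.add k1, by simp [h2, k2], fun x hx hx' => ?_⟩
    rcases hx with hx | hx
    · linarith [h3 x hx hx', hx' k k1 k2]
    · linarith [k3 x hx hx', hx' h h1 h2]
  · intro x hx
    by_cases hxS : ∀ g : M → ℝ, IsBoundedPsh E g → g w₀ = 0 → g x ≤ 0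
    · have key : ∃ h : M → ℝ, IsBoundedPsh E h ∧ h w₀ = 0 ∧ u x + h x < 0 := by
        by_cases hxA : x ∈ Acbe E w₀
        · exact ⟨fun _ => 0, IsBoundedPsh.const 0, rfl, by simpa using hneg x ⟨hxA, hx⟩⟩
        · rw [mem_Acbe_iff] at hxA
          push Not at hxA
          obtain ⟨g, hg, hne⟩ := hxA
          have hlt : g x - g w₀ < 0 :=
            lt_of_le_of_ne (hxS _ (hg.sub_const (g w₀)) (sub_self _)) (sub_ne_zero.2 hne)
          -- With this factor the multiple of g - g w₀ equals -(|u x| + 1) at x, which outweighs u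
          -- x.
          have hc : 0 ≤ (|u x| + 1) / (g w₀ - g x) := by
            have : 0 < g w₀ - g x := by linarith
            positivity
          refine ⟨_, (hg.sub_const (g w₀)).const_mul hc, by simp, ?_⟩
          have : (|u x| + 1) / (g w₀ - g x) * (g x - g w₀) = -(|u x| + 1) := by
            have : g w₀ - g x ≠ 0 := by linarith
            field_simp
            ring
          rw [this]
          linarith [le_abs_self (u x)]
      obtain ⟨h, h1, h2, h3⟩ := key
      refine ⟨{y | u y + h y < 0}, mem_nhdsWithin_of_mem_nhds ?_, h, h1, h2, fun y hy _ => hy⟩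
      exact ((hu x hx).add h1.continuous.continuousAt).eventually_lt continuousAt_const h3
    · push Not at hxS
      obtain ⟨g, hg, hg0, hgx⟩ := hxS
      -- The function g stays positive near x, so the condition on points fails there and nothing is
      -- to be proved.
      refine ⟨{y | 0 < g y}, mem_nhdsWithin_of_mem_nhds ?_, fun _ => 0, IsBoundedPsh.const 0, rfl,
        fun y hy hy' => absurd (hy' g hg hg0) (not_le.2 hy)⟩
      exact hg.continuous.continuousAt.eventually (lt_mem_nhds hgx)

/-- Where u is negative, 0 dominates it; elsewhere a large multiple of some positive g does.
Finitely many such functions are combined by `max`, which keeps the value 0 at w₀. -/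
theorem exists_lt_of_neg {w₀ : M} {K : Set M} (hK : IsCompact K) {u : M → ℝ}
    (hu : ∀ x ∈ K, ContinuousAt u x)
    (hneg : ∀ x ∈ K, (∀ g : M → ℝ, IsBoundedPsh E g → g w₀ = 0 → g x ≤ 0) → u x < 0) :
    ∃ v : M → ℝ, IsBoundedPsh E v ∧ v w₀ = 0 ∧ ∀ x ∈ K, u x < v x := by
  refine hK.induction_on (p := fun s => ∃ v : M → ℝ, IsBoundedPsh E v ∧ v w₀ = 0 ∧
    ∀ x ∈ s, u x < v x) ?_ ?_ ?_ ?_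
  · exact ⟨fun _ => 0, IsBoundedPsh.const 0, rfl, by simp⟩
  · rintro s t hst ⟨h, h1, h2, h3⟩
    exact ⟨h, h1, h2, fun x hx => h3 x (hst hx)⟩
  · rintro s t ⟨h, h1, h2, h3⟩ ⟨k, k1, k2, k3⟩
    refine ⟨fun x => max (h x) (k x), h1.max k1, by simp [h2, k2], fun x hx => ?_⟩
    rcases hx with hx | hx
    · exact (h3 x hx).trans_le (le_max_left _ _)
    · exact (k3 x hx).trans_le (le_max_right _ _)
  · intro x hx
    have key : ∃ v : M → ℝ, IsBoundedPsh E v ∧ v w₀ = 0 ∧ u x < v x := by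
      by_cases hxS : ∀ g : M → ℝ, IsBoundedPsh E g → g w₀ = 0 → g x ≤ 0
      · exact ⟨fun _ => 0, IsBoundedPsh.const 0, rfl, hneg x hx hxS⟩
      · push Not at hxS
        obtain ⟨g, hg, hg0, hgx⟩ := hxS
        refine ⟨_, hg.const_mul (c := (|u x| + 1) / g x) (by positivity), by simp [hg0], ?_⟩
        rw [div_mul_cancel₀ _ hgx.ne']
        linarith [le_abs_self (u x)]
    obtain ⟨v, h1, h2, h3⟩ := key
    exact ⟨{y | u y < v y}, mem_nhdsWithin_of_mem_nhds
      ((hu x hx).eventually_lt h1.continuous.continuousAt h3), v, h1, h2, fun y hy => hy⟩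

/-- If a plurisubharmonic function near `closure U` is positive at a point `z₁` of
`Acbe E w₀ ∩ U` and negative on `Acbe E w₀ ∩ frontier U`, then `Acbe E w₀ ⊆ U`, and a function of
the class differs near `z₁` from `u` by a function of the class. -/
theorem Acbe_subset_of_peak {w₀ z₁ : M} {U : Set M} (hU : IsOpen U) (hUc : IsCompact (closure U))
    {u : M → ℝ} (hu : ∀ x ∈ closure U, IsPshAt E u x) (hz : z₁ ∈ Acbe E w₀) (hzU : z₁ ∈ U)
    (hpos : 0 < u z₁) (hneg : ∀ x ∈ Acbe E w₀ ∩ frontier U, u x < 0) :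
    Acbe E w₀ ⊆ U ∧ ∃ h w : M → ℝ, IsBoundedPsh E h ∧ IsBoundedPsh E w ∧
      ∀ᶠ x in 𝓝 z₁, w x = u x + h x := by
  have hfr : IsCompact (frontier U) :=
    hUc.of_isClosed_subset isClosed_frontier frontier_subset_closure
  obtain ⟨h, h1, h2, h3⟩ := exists_add_neg hfr
    (fun x hx => (hu x (frontier_subset_closure hx)).continuousAt) hneg
  have hu' : ∀ x ∈ closure U, IsPshAt E (fun x => u x + h x) x := fun x hx =>
    (hu x hx).add (h1.isPshAt x)
  obtain ⟨v, v1, v2, v3⟩ := exists_lt_of_neg hfr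
    (fun x hx => (hu' x (frontier_subset_closure hx)).continuousAt) h3
  obtain ⟨w, w1, w2, w3⟩ := IsBoundedPsh.glue hU hUc hu' v1 v3
  have hA : ∀ a ∈ Acbe E w₀, ∀ g : M → ℝ, IsBoundedPsh E g → g w₀ = 0 → g a = 0 :=
    fun a ha g hg hg0 => (mem_Acbe_iff.1 ha g hg).trans hg0
  have hwz : 0 < w z₁ := by
    rw [w2 z₁ hzU, hA z₁ hz h h1 h2, add_zero]
    exact lt_max_of_lt_left hpos
  refine ⟨fun a ha => ?_, h, w, h1, w1, ?_⟩
  · by_contra haU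
    have e1 := mem_Acbe_iff.1 ha w w1
    have e2 := mem_Acbe_iff.1 hz w w1
    rw [w3 a haU, hA a ha v v1 v2] at e1
    linarith
  · have hlt : v z₁ < u z₁ + h z₁ := by
      rw [hA z₁ hz h h1 h2, hA z₁ hz v v1 v2, add_zero]
      exact hpos
    filter_upwards [hU.mem_nhds hzU, v1.continuous.continuousAt.eventually_lt
      (hu' z₁ (subset_closure hzU)).continuousAt hlt] with y hy hy'
    rw [w2 y hy]
    exact max_eq_left hy'.le

end Manifold

/-! ### Regularisation by sup-convolution and the maximum principle. -/

/-- The sup-convolution of `u` over the set `C` with the cone of slope `k`. -/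
def supConvolution {E : Type*} [NormedAddCommGroup E] (u : E → ℝ) (C : Set E) (k : ℝ) (p : E) : ℝ :=
  ⨆ y : C, (u y - k * ‖(y : E) - p‖)

section SupConvolution

variable {E : Type*} [NormedAddCommGroup E] {u : E → ℝ} {C : Set E} {k B : ℝ}

theorem sub_le_supConvolution (hk : 0 ≤ k) (hB : ∀ y ∈ C, u y ≤ B) {y : E} (hy : y ∈ C) (p : E) :
    u y - k * ‖y - p‖ ≤ supConvolution u C k p := by
  refine le_ciSup (f := fun y : C => u y - k * ‖(y : E) - p‖) ⟨B, ?_⟩ ⟨y, hy⟩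
  rintro _ ⟨x, rfl⟩
  have := hB x x.2
  have : 0 ≤ k * ‖(x : E) - p‖ := by positivity
  dsimp only
  linarith

theorem supConvolution_le (hC : C.Nonempty) {p : E} {c : ℝ}
    (h : ∀ y ∈ C, u y - k * ‖y - p‖ ≤ c) : supConvolution u C k p ≤ c := by
  have := hC.to_subtype
  exact ciSup_le fun y => h y y.2

theorem continuous_supConvolution (hC : C.Nonempty) (hk : 0 ≤ k) (hB : ∀ y ∈ C, u y ≤ B) :
    Continuous (supConvolution u C k) := by
  refine (LipschitzWith.of_le_add_mul k.toNNReal fun p q => ?_).continuous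
  refine supConvolution_le hC fun y hy => ?_
  have h1 := sub_le_supConvolution hk hB hy q
  have h2 : ‖y - q‖ ≤ ‖y - p‖ + dist p q := by
    rw [dist_eq_norm]; exact norm_sub_le_norm_sub_add_norm_sub y p q
  have h3 := mul_le_mul_of_nonneg_left h2 hk
  rw [Real.coe_toNNReal k hk]
  linarith

end SupConvolution

section Manifold

variable {E : Type*} [NormedAddCommGroup E] [NormedSpace ℂ E]
  {M : Type*} [TopologicalSpace M] [ChartedSpace E M]

/-- A plurisubharmonic function on an open subset `V` of a chart domain is approximated from above,
on a compact subset `K`, by continuous functions that are plurisubharmonic at the points of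
`K`. -/
theorem PlurisubharmonicOn.exists_isPshAt_ge [FiniteDimensional ℂ E] [IsManifold 𝓘(ℂ, E) ω M]
    {u : M → EReal} {V K B : Set M} {x₀ : M} (hV : IsOpen V) (hVs : V ⊆ (chartAt E x₀).source)
    (hu : PlurisubharmonicOn E u V) (hK : IsCompact K) (hKV : K ⊆ V) (hB : IsCompact B)
    (hBK : B ⊆ K) {c : ℝ} (hc : ∀ x ∈ B, u x < c) :
    ∃ g : M → ℝ, (∀ x ∈ K, IsPshAt E g x) ∧ (∀ x ∈ K, u x ≤ g x) ∧ ∀ x ∈ B, g x ≤ c := by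
  have : ProperSpace E := FiniteDimensional.proper ℂ E
  rcases K.eq_empty_or_nonempty with rfl | hKne
  · exact ⟨fun _ => 0, by simp, by simp, fun x hx => absurd (hBK hx) (Set.notMem_empty x)⟩
  set e := chartAt E x₀ with he
  have hemd := mdifferentiable_chart (I := 𝓘(ℂ, E)) x₀
  -- Truncation strictly below c keeps the truncated function below c on B.
  set m : ℝ := c - 1 with hm
  set W : Set E := e.target ∩ e.symm ⁻¹' V with hW
  have hWo : IsOpen W := e.isOpen_inter_preimage_symm hV
  have heV : ∀ x ∈ V, e x ∈ W := fun x hx =>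
    ⟨e.map_source (hVs hx), by simpa [e.left_inv (hVs hx)] using hx⟩
  have hce : ContinuousOn e K := e.continuousOn.mono (hKV.trans hVs)
  have heK : IsCompact (e '' K) := hK.image_of_continuousOn hce
  have heB : IsCompact (e '' B) := hB.image_of_continuousOn (hce.mono hBK)
  obtain ⟨δ, hδ, hδW⟩ := heK.exists_cthickening_subset_open hWo
    (by rintro _ ⟨x, hx, rfl⟩; exact heV x (hKV hx))
  set C := Metric.cthickening δ (e '' K) with hC
  have hCc : IsCompact C := heK.cthickening
  have hKC : ∀ x ∈ K, e x ∈ C := fun x hx =>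
    Metric.self_subset_cthickening _ ⟨x, hx, rfl⟩
  have hCne : C.Nonempty := hKne.imp (fun x hx => hKC x hx) |> fun ⟨x, hx⟩ => ⟨e x, hx⟩
  set v : E → ℝ := fun y => truncBelow m (u (e.symm y)) with hv
  have hvusc : UpperSemicontinuousOn v C := by
    have h1 := upperSemicontinuousOn_truncBelow hu.usc hu.lt_top m
    exact UpperSemicontinuousOn.comp (f := fun x => truncBelow m (u x)) h1
      (e.continuousOn_symm.mono (hδW.trans Set.inter_subset_left)) (fun y hy => (hδW hy).2)
  have hvm : ∀ y ∈ C, m ≤ v y := fun y hy => le_truncBelow (hu.lt_top _ (hδW hy).2)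
  obtain ⟨b, hb⟩ := hvusc.bddAbove_of_isCompact hCc
  replace hb : ∀ y ∈ C, v y ≤ b := fun y hy => hb ⟨y, hy, rfl⟩
  have hve : ∀ x ∈ K, v (e x) = truncBelow m (u x) := fun x hx => by
    simp only [hv, e.left_inv (hVs (hKV hx))]
  obtain ⟨d, hd, hdB⟩ : ∃ d > 0, Metric.thickening d (e '' B) ⊆ (C ∩ v ⁻¹' Set.Ici c)ᶜ := by
    refine heB.exists_thickening_subset_open
      (hvusc.isCompact_inter_preimage_Ici hCc c).isClosed.isOpen_compl ?_
    rintro _ ⟨x, hx, rfl⟩ ⟨_, h2⟩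
    have h3 : c ≤ v (e x) := h2
    rw [hve x (hBK hx)] at h3
    exact absurd h3 (not_le.2 ((truncBelow_lt_iff (hu.lt_top x (hKV (hBK hx)))).2
      ⟨hc x hx, by rw [hm]; linarith⟩))
  have hbm : m ≤ b := by
    obtain ⟨y, hy⟩ := hCne
    exact (hvm y hy).trans (hb y hy)
  -- The oscillation of v on C is at most b - m. The summand 2 / δ keeps maximisers within δ / 2 of
  -- the base point; 1 / d makes points at distance at least d from a point of e '' B irrelevant for
  -- the bound c.
  set k : ℝ := (b - m + 1) * (2 / δ + 1 / d) with hkdef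
  have hk : 0 ≤ k := by
    have : 0 ≤ b - m + 1 := by linarith
    positivity
  have hkδ : b - m < k * (δ / 2) := by
    have h1 : (b - m + 1) * (2 / δ) * (δ / 2) = b - m + 1 := by field_simp
    have h2 : 0 ≤ (b - m + 1) * (1 / d) * (δ / 2) := by
      have : 0 ≤ b - m + 1 := by linarith
      positivity
    rw [hkdef]; linarith
  have hkd : b - m ≤ k * d := by
    have h1 : (b - m + 1) * (1 / d) * d = b - m + 1 := by field_simp
    have h2 : 0 ≤ (b - m + 1) * (2 / δ) * d := by
      have : 0 ≤ b - m + 1 := by linarith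
      positivity
    rw [hkdef]; linarith
  have hGc := continuous_supConvolution hCne hk hb
  refine ⟨fun x => supConvolution v C k (e x), fun x hx => ⟨?_, ?_⟩, fun x hx => ?_, fun x hx => ?_⟩
  · filter_upwards [e.open_source.mem_nhds (hVs (hKV hx))] with y hy
    exact hGc.continuousAt.comp (e.continuousAt hy)
  · intro f a hfa hf
    have hxs : x ∈ e.source := hVs (hKV hx)
    -- The supremum is attained at y₀ = e x + ζ. The translate of v by ζ, minus k * ‖ζ‖, then
    -- touches the sup-convolution from below at e x, and its sub-mean value inequality is that of u
    -- on the translated disc F.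
    obtain ⟨y₀, hy₀, hmax⟩ := UpperSemicontinuousOn.exists_isMaxOn hCne hCc
      (hvusc.add (g := fun y => -(k * ‖y - e x‖))
        (Continuous.continuousOn (by fun_prop)).upperSemicontinuousOn)
    have hmax' : supConvolution v C k (e x) ≤ v y₀ - k * ‖y₀ - e x‖ :=
      supConvolution_le hCne fun y hy => by
        have : v y + -(k * ‖y - e x‖) ≤ v y₀ + -(k * ‖y₀ - e x‖) := hmax hy
        linarith
    set ζ : E := y₀ - e x with hζ
    have hζn : ‖ζ‖ < δ / 2 := by
      have h1 := sub_le_supConvolution hk hb (hKC x hx) (e x)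
      rw [sub_self, norm_zero, mul_zero, sub_zero] at h1
      have h2 := hvm _ (hKC x hx)
      have h3 := hb y₀ hy₀
      by_contra! h4
      have := mul_le_mul_of_nonneg_left h4 hk
      linarith
    have hy₀' : y₀ = e x + ζ := by rw [hζ]; abel
    have hfc : ContinuousAt f a := hf.self_of_nhds.continuousAt
    have hefc : ContinuousAt (fun z => e (f z)) a :=
      ContinuousAt.comp (g := e) (by rw [hfa]; exact e.continuousAt hxs) hfc
    have hnear : ∀ᶠ z in 𝓝 a, f z ∈ e.source ∧ e (f z) + ζ ∈ C := by
      have h1 : ∀ᶠ z in 𝓝 a, f z ∈ e.source :=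
        hfc.eventually (by rw [hfa]; exact e.open_source.mem_nhds hxs)
      have h2 : ∀ᶠ z in 𝓝 a, dist (e (f z)) (e x) < δ / 2 := by
        have := hefc.eventually (Metric.ball_mem_nhds (e (f a)) (half_pos hδ))
        rwa [hfa] at this
      filter_upwards [h1, h2] with z hz1 hz2
      refine ⟨hz1, Metric.mem_cthickening_of_dist_le _ (e x) _ _ ⟨x, hx, rfl⟩ ?_⟩
      have h3 : dist (e (f z) + ζ) (e x) ≤ dist (e (f z)) (e x) + ‖ζ‖ := by
        rw [dist_eq_norm, dist_eq_norm, add_sub_right_comm]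
        exact norm_add_le _ _
      linarith
    set F : ℂ → M := fun z => e.symm (e (f z) + ζ) with hF
    have hFa : F a = e.symm y₀ := by rw [hF, hy₀']; simp only [hfa]
    have hFd : ∀ᶠ z in 𝓝 a, MDifferentiableAt 𝓘(ℂ, ℂ) 𝓘(ℂ, E) F z := by
      filter_upwards [hnear, hf] with z hz hfz
      have h1 : MDifferentiableAt 𝓘(ℂ, ℂ) 𝓘(ℂ, E) (fun z => e (f z)) z :=
        (hemd.mdifferentiableAt hz.1).comp z hfz
      have h2 : MDifferentiableAt 𝓘(ℂ, ℂ) 𝓘(ℂ, E) (fun z => e (f z) + ζ) z :=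
        (h1.differentiableAt.add_const ζ).mdifferentiableAt
      exact (hemd.mdifferentiableAt_symm (hδW hz.2).1).comp z h2
    have hFV : F a ∈ V := by rw [hFa]; exact (hδW hy₀).2
    filter_upwards [hu.eventually_truncBelow hV m hFV hFd, hnear.forall_closedBall,
      self_mem_nhdsWithin, eventually_circleIntegrable
        (g := fun x => supConvolution v C k (e x)) (x := x) (by
          filter_upwards [e.open_source.mem_nhds hxs] with y hy
          exact hGc.continuousAt.comp (e.continuousAt hy)) hfa hf] with r hr hnr hr0 hi
    have h1 : Real.circleAverage (fun z => truncBelow m (u (F z)) - k * ‖ζ‖) a r ≤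
        Real.circleAverage ((fun x => supConvolution v C k (e x)) ∘ f) a r := by
      refine Real.circleAverage_mono (hr.1.sub (circleIntegrable_const _ _ _)) hi fun z hz => ?_
      rw [abs_of_pos hr0] at hz
      have h2 := hnr z (Metric.sphere_subset_closedBall hz)
      have h3 := sub_le_supConvolution hk hb h2.2 (e (f z))
      rwa [add_sub_cancel_left] at h3
    rw [Real.circleAverage_fun_sub hr.1 (circleIntegrable_const _ _ _), Real.circleAverage_const]
      at h1
    have h2 := hr.2
    rw [hFa] at h2
    have h3 : v y₀ = truncBelow m (u (e.symm y₀)) := rfl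
    linarith
  · have h1 := sub_le_supConvolution hk hb (hKC x hx) (e x)
    rw [sub_self, norm_zero, mul_zero, sub_zero, hve x hx] at h1
    exact ((truncBelow_le_iff (hu.lt_top x (hKV hx))).1 h1).1
  · refine supConvolution_le hCne fun y hy => ?_
    by_cases hyc : c ≤ v y
    · have h1 : d ≤ ‖y - e x‖ := by
        by_contra! h
        exact hdB (Metric.mem_thickening_iff.2 ⟨e x, ⟨x, hx, rfl⟩, by rwa [dist_eq_norm]⟩) ⟨hy, hyc⟩
      have h2 := mul_le_mul_of_nonneg_left h1 hk
      have h3 := hb y hy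
      have h4 : m ≤ c := by rw [hm]; linarith
      linarith
    · have : 0 ≤ k * ‖y - e x‖ := by positivity
      linarith

/-- The maximum principle of the local maximum property, for `Acbe E w₀`. -/
theorem iSup_Acbe_closure_le [FiniteDimensional ℂ E] [IsManifold 𝓘(ℂ, E) ω M]
    [T2Space M] {w₀ x₀ : M} {U V : Set M} (hV : IsOpen V) (hVs : V ⊆ (chartAt E x₀).source)
    (hU : IsOpen U) (hUc : IsCompact (closure U)) (hUV : closure U ⊆ V)
    (hne : (Acbe E w₀ ∩ frontier U).Nonempty) {u : M → EReal} (hu : PlurisubharmonicOn E u V) :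
    (⨆ x ∈ Acbe E w₀ ∩ closure U, u x) ≤ ⨆ x ∈ Acbe E w₀ ∩ frontier U, u x := by
  refine iSup₂_le fun z₁ hz₁ => ?_
  by_contra! hlt
  -- Two levels c < c' are needed: the regularisation is only ≤ c on the frontier, and subtracting
  -- c' makes it strictly negative there.
  obtain ⟨c', hc', hcz⟩ := EReal.lt_iff_exists_real_btwn.1 hlt
  obtain ⟨c, hc, hcc⟩ := EReal.lt_iff_exists_real_btwn.1 hc'
  have hB : ∀ x ∈ Acbe E w₀ ∩ frontier U, u x < c := fun x hx =>
    (le_iSup₂ (f := fun x (_ : x ∈ Acbe E w₀ ∩ frontier U) => u x) x hx).trans_lt hc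
  have hfr : IsCompact (frontier U) :=
    hUc.of_isClosed_subset isClosed_frontier frontier_subset_closure
  obtain ⟨g, g1, g2, g3⟩ := hu.exists_isPshAt_ge hV hVs hUc hUV
    (hfr.inter_left (isClosed_Acbe w₀)) (Set.inter_subset_right.trans frontier_subset_closure) hB
  rw [EReal.coe_lt_coe_iff] at hcc
  have hzU : z₁ ∈ U := by
    by_contra h
    have := hB z₁ ⟨hz₁.1, by rw [hU.frontier_eq]; exact ⟨hz₁.2, h⟩⟩
    exact absurd (this.trans (EReal.coe_lt_coe hcc)) hcz.not_gt
  have hgz : c' < g z₁ := EReal.coe_lt_coe_iff.1 (hcz.trans_le (g2 z₁ hz₁.2))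
  obtain ⟨hsub, -⟩ := Acbe_subset_of_peak hU hUc (u := fun x => g x + -c')
    (fun x hx => (g1 x hx).add (IsPshAt.const (-c') x)) hz₁.1 hzU (by linarith)
    (fun x hx => by linarith [g3 x hx])
  obtain ⟨y, hyA, hyf⟩ := hne
  rw [hU.frontier_eq] at hyf
  exact hyf.2 (hsub hyA)

end Manifold

/-! ### The squared Euclidean norm in a chart and its plurisubharmonicity. -/

section LeviForm

variable {E : Type*} [NormedAddCommGroup E] [NormedSpace ℂ E]
  {F : Type*} [NormedAddCommGroup F] [InnerProductSpace ℂ F]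

theorem contDiff_normSq_comp_sub (L : E →L[ℂ] F) (p : E) (c : ℝ) {n : WithTop ℕ∞} :
    ContDiff ℝ n fun y => ‖L (y - p)‖ ^ 2 + c := by
  have : InnerProductSpace ℝ F := InnerProductSpace.complexToReal
  have h : ContDiff ℝ n fun y => L.restrictScalars ℝ (y - p) := by fun_prop
  exact (h.norm_sq ℝ).add contDiff_const

/-- The real second derivative on (w, w) is 2‖L w‖², and v and iv contribute equally because L is
complex linear. -/
theorem leviForm_normSq_comp_sub (L : E →L[ℂ] F) (p : E) (c : ℝ) (z v : E) :
    leviForm (fun y => ‖L (y - p)‖ ^ 2 + c) z v = ‖L v‖ ^ 2 := by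
  let _ : InnerProductSpace ℝ F := InnerProductSpace.complexToReal
  set φ : E → ℝ := fun y => ‖L (y - p)‖ ^ 2 + c with hφ
  have hL : ∀ y, HasFDerivAt (fun y => L (y - p)) (L.restrictScalars ℝ) y := fun y =>
    (L.restrictScalars ℝ).hasFDerivAt.comp y ((hasFDerivAt_id y).sub_const p)
  have h1 : ∀ y w, fderiv ℝ φ y w = 2 * inner ℝ (L (y - p)) (L w) := by
    intro y w
    rw [((hL y).norm_sq.add_const c).fderiv]
    simp [inner_sub_left]
  have hd : DifferentiableAt ℝ (fderiv ℝ φ) z :=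
    ((contDiff_normSq_comp_sub L p c (n := 2)).fderiv_right
      (m := 1) (by norm_num)).differentiable (by norm_num) z
  have h2 : ∀ w, fderiv ℝ (fderiv ℝ φ) z w w = 2 * ‖L w‖ ^ 2 := by
    intro w
    have e1 : HasFDerivAt (fun y => fderiv ℝ φ y w)
        ((ContinuousLinearMap.apply ℝ ℝ w).comp (fderiv ℝ (fderiv ℝ φ) z)) z :=
      (ContinuousLinearMap.apply ℝ ℝ w).hasFDerivAt.comp z hd.hasFDerivAt
    have e2 := (((hL z).inner ℝ (hasFDerivAt_const (L w) z)).const_mul 2)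
    have e3 : (fun y => fderiv ℝ φ y w) = fun y => 2 * inner ℝ (L (y - p)) (L w) :=
      funext fun y => h1 y w
    rw [e3] at e1
    have := congrArg (fun T : E →L[ℝ] ℝ => T w) (e1.unique e2)
    simpa [real_inner_self_eq_norm_sq] using this
  rw [leviForm, h2, h2, map_smul, norm_smul, Complex.norm_I]
  ring

end LeviForm

section Manifold

variable {E : Type*} [NormedAddCommGroup E] [NormedSpace ℂ E]
  {F : Type*} [NormedAddCommGroup F] [InnerProductSpace ℂ F]
  {M : Type*} [TopologicalSpace M] [ChartedSpace E M]

/-- The function `‖L (z - z₀)‖²` in the preferred chart `z` at `z₀`. -/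
def chartNormSq (L : E →L[ℂ] F) (z₀ x : M) : ℝ :=
  ‖L (chartAt E z₀ x - chartAt E z₀ z₀)‖ ^ 2

theorem chartNormSq_self (L : E →L[ℂ] F) (z₀ : M) : chartNormSq L z₀ z₀ = 0 := by
  simp [chartNormSq]

theorem eventually_continuousAt_chartNormSq (L : E →L[ℂ] F) {z₀ x : M}
    (hx : x ∈ (chartAt E z₀).source) : ∀ᶠ y in 𝓝 x, ContinuousAt (chartNormSq L z₀) y := by
  filter_upwards [(chartAt E z₀).open_source.mem_nhds hx] with y hy
  have h1 := (chartAt E z₀).continuousAt hy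
  unfold chartNormSq
  fun_prop

/-- A function that agrees near `w` with `chartNormSq` up to a constant is smooth and strictly
plurisubharmonic near `w`. -/
theorem smoothStrictlyPSHNear_of_eventuallyEq (L : E ≃L[ℂ] F) {g : M → ℝ} {w : M} {c : ℝ}
    (hg : ∀ᶠ x in 𝓝 w, g x = chartNormSq (L : E →L[ℂ] F) w x + c) :
    SmoothStrictlyPSHNear E (fun x => (g x : EReal)) w := by
  refine ⟨Filter.Eventually.of_forall fun x => ⟨EReal.coe_ne_bot _, EReal.coe_ne_top _⟩, ?_⟩
  set e := chartAt E w
  have hw : w ∈ e.source := mem_chart_source E w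
  have h1 : ∀ᶠ y in 𝓝 (e w), ((g (e.symm y) : ℝ) : EReal).toReal =
      ‖(L : E →L[ℂ] F) (y - e w)‖ ^ 2 + c := by
    have h2 : Filter.Tendsto e.symm (𝓝 (e w)) (𝓝 w) := by
      have := e.continuousAt_symm (e.map_source hw)
      rwa [ContinuousAt, e.left_inv hw] at this
    filter_upwards [h2.eventually hg, e.open_target.mem_nhds (e.map_source hw)] with y hy hyt
    rw [EReal.toReal_coe, hy, chartNormSq]
    change ‖(L : E →L[ℂ] F) (e (e.symm y) - e w)‖ ^ 2 + c = _
    rw [e.right_inv hyt]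
  filter_upwards [h1.eventually_nhds] with z hz
  refine ⟨(contDiff_normSq_comp_sub (L : E →L[ℂ] F) (e w) c).contDiffAt.congr_of_eventuallyEq hz,
    fun v hv => ?_⟩
  have h3 := leviForm_normSq_comp_sub (L : E →L[ℂ] F) (e w) c z v
  rw [leviForm] at h3 ⊢
  rw [(Filter.EventuallyEq.fderiv (𝕜 := ℝ) hz).fderiv_eq, h3]
  have : L v ≠ 0 := by simpa using hv
  have : 0 < ‖L v‖ := norm_pos_iff.2 this
  exact pow_pos this 2

/-- The ball `{‖L (z - z₀)‖² < s}` in the preferred chart `z` at `z₀`. -/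
def chartBall (L : E →L[ℂ] F) (z₀ : M) (s : ℝ) : Set M :=
  (chartAt E z₀).source ∩ {x | chartNormSq L z₀ x < s}

theorem mem_chartBall_self (L : E →L[ℂ] F) (z₀ : M) {s : ℝ} (hs : 0 < s) :
    z₀ ∈ chartBall L z₀ s :=
  ⟨mem_chart_source E z₀, by simpa [chartNormSq_self] using hs⟩

theorem isOpen_chartBall (L : E →L[ℂ] F) (z₀ : M) (s : ℝ) : IsOpen (chartBall L z₀ s) := by
  refine isOpen_iff_mem_nhds.2 fun x hx => ?_
  filter_upwards [(chartAt E z₀).open_source.mem_nhds hx.1,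
    (eventually_continuousAt_chartNormSq L hx.1).self_of_nhds.eventually (gt_mem_nhds hx.2)]
    with y h1 h2 using ⟨h1, h2⟩

/-- Small chart balls are relatively compact, lie in a given neighbourhood of the center, and their
boundary points have the expected distance from the center. -/
theorem exists_chartBall [T2Space M] [FiniteDimensional ℂ E] (L : E ≃L[ℂ] F) {z₀ : M} {N : Set M}
    (hN : N ∈ 𝓝 z₀) :
    ∃ s > 0, IsCompact (closure (chartBall (L : E →L[ℂ] F) z₀ s)) ∧
      closure (chartBall (L : E →L[ℂ] F) z₀ s) ⊆ (chartAt E z₀).source ∩ N ∧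
      ∀ x ∈ frontier (chartBall (L : E →L[ℂ] F) z₀ s), chartNormSq (L : E →L[ℂ] F) z₀ x = s := by
  have : ProperSpace E := FiniteDimensional.proper ℂ E
  set e := chartAt E z₀ with he
  have hz₀ : z₀ ∈ e.source := mem_chart_source E z₀
  have h1 : e.target ∩ e.symm ⁻¹' N ∈ 𝓝 (e z₀) := by
    refine Filter.inter_mem (e.open_target.mem_nhds (e.map_source hz₀)) ?_
    refine e.continuousAt_symm (e.map_source hz₀) ?_
    rwa [e.left_inv hz₀]
  have h2 : ∀ᶠ y in 𝓝 (0 : F), L.symm y + e z₀ ∈ e.target ∩ e.symm ⁻¹' N := by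
    have : ContinuousAt (fun y => L.symm y + e z₀) (0 : F) := by fun_prop
    refine this.eventually_mem ?_
    rwa [map_zero, zero_add]
  obtain ⟨r, hr, hrN⟩ := Metric.nhds_basis_closedBall.eventually_iff.1 h2
  set K : Set E := {y | ‖L (y - e z₀)‖ ≤ r} with hK
  have hKN : K ⊆ e.target ∩ e.symm ⁻¹' N := by
    intro y hy
    have := hrN (x := L (y - e z₀)) (mem_closedBall_zero_iff.2 hy)
    simpa using this
  have hKc : IsCompact K := by
    have : K = (fun y => L.symm y + e z₀) '' Metric.closedBall 0 r := by
      ext y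
      refine ⟨fun hy => ⟨L (y - e z₀), mem_closedBall_zero_iff.2 hy, by simp⟩, ?_⟩
      rintro ⟨x, hx, rfl⟩
      simpa [hK, -map_add, -map_sub] using hx
    rw [this]
    have : ProperSpace F := by
      have := L.toLinearEquiv.finiteDimensional
      exact FiniteDimensional.proper ℂ F
    exact (isCompact_closedBall _ _).image (by fun_prop)
  have hKc' : IsCompact (e.symm '' K) :=
    hKc.image_of_continuousOn (e.continuousOn_symm.mono (hKN.trans Set.inter_subset_left))
  have hUK : chartBall (L : E →L[ℂ] F) z₀ (r ^ 2) ⊆ e.symm '' K := by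
    intro x hx
    refine ⟨e x, ?_, e.left_inv hx.1⟩
    have h3 : ‖L (e x - e z₀)‖ ^ 2 < r ^ 2 := hx.2
    exact (lt_of_pow_lt_pow_left₀ 2 hr.le h3).le
  have hcl : closure (chartBall (L : E →L[ℂ] F) z₀ (r ^ 2)) ⊆ e.symm '' K :=
    closure_minimal hUK hKc'.isClosed
  refine ⟨r ^ 2, by positivity, hKc'.of_isClosed_subset isClosed_closure hcl, fun x hx => ?_,
    fun x hx => ?_⟩
  · obtain ⟨y, hy, rfl⟩ := hcl hx
    exact ⟨e.map_target (hKN hy).1, (hKN hy).2⟩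
  · rw [(isOpen_chartBall _ _ _).frontier_eq] at hx
    obtain ⟨y, hy, rfl⟩ := hcl hx.1
    have hyt := (hKN hy).1
    refine le_antisymm ?_ ?_
    · change ‖L (e (e.symm y) - e z₀)‖ ^ 2 ≤ r ^ 2
      rw [e.right_inv hyt]
      exact pow_le_pow_left₀ (norm_nonneg _) hy 2
    · by_contra! h
      exact hx.2 ⟨e.map_target hyt, h⟩

variable [IsManifold 𝓘(ℂ, E) ω M]

theorem mdifferentiableAt_clm_chartAt {G : Type*} [NormedAddCommGroup G] [NormedSpace ℂ G]
    (T : E →L[ℂ] G) {z₀ x : M} (hx : x ∈ (chartAt E z₀).source) :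
    MDifferentiableAt 𝓘(ℂ, E) 𝓘(ℂ, G) (fun y => T (chartAt E z₀ y - chartAt E z₀ z₀)) x := by
  have h1 : MDifferentiableAt 𝓘(ℂ, E) 𝓘(ℂ, E) (chartAt E z₀) x :=
    (mdifferentiable_chart (I := 𝓘(ℂ, E)) z₀).mdifferentiableAt hx
  have h2 : DifferentiableAt ℂ (fun y => T (y - chartAt E z₀ z₀)) (chartAt E z₀ x) := by fun_prop
  exact h2.mdifferentiableAt.comp x h1

/-- The pluriharmonic function 2 Re⟨b, ·⟩ - ‖b‖² touches the squared norm from below at b. -/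
theorem isPshAt_chartNormSq (L : E →L[ℂ] F) {z₀ x : M} (hx : x ∈ (chartAt E z₀).source) :
    IsPshAt E (chartNormSq L z₀) x := by
  set b : F := L (chartAt E z₀ x - chartAt E z₀ z₀) with hb
  have h1 := IsPshAt.re_of_mdifferentiableAt (E := E) (x := x)
    (P := fun y => ((innerSL ℂ b).comp L) (chartAt E z₀ y - chartAt E z₀ z₀)) (by
      filter_upwards [(chartAt E z₀).open_source.mem_nhds hx] with y hy
      exact mdifferentiableAt_clm_chartAt _ hy)
  refine ((h1.const_mul zero_le_two).add (IsPshAt.const (-‖b‖ ^ 2) x)).of_le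
    (eventually_continuousAt_chartNormSq L hx) (Filter.Eventually.of_forall fun y => ?_) ?_
  · have := norm_sub_sq (𝕜 := ℂ) b (L (chartAt E z₀ y - chartAt E z₀ z₀))
    have h3 := sq_nonneg ‖b - L (chartAt E z₀ y - chartAt E z₀ z₀)‖
    simp only [ContinuousLinearMap.comp_apply, innerSL_apply_apply, chartNormSq]
    simp only [RCLike.re_to_complex] at this
    linarith
  · have := inner_self_eq_norm_sq (𝕜 := ℂ) b
    simp only [ContinuousLinearMap.comp_apply, innerSL_apply_apply, chartNormSq, ← hb]
    simp only [RCLike.re_to_complex] at this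
    linarith

theorem isPshAt_log_chartNormSq (L : E →L[ℂ] F) {z₀ x : M} (hx : x ∈ (chartAt E z₀).source)
    (hne : chartNormSq L z₀ x ≠ 0) : IsPshAt E (fun y => Real.log (chartNormSq L z₀ y)) x := by
  set b : F := L (chartAt E z₀ x - chartAt E z₀ z₀) with hb
  have hb0 : 0 < ‖b‖ := by
    rw [norm_pos_iff]
    rintro h
    exact hne (by rw [chartNormSq, ← hb, h]; simp)
  -- By Cauchy–Schwarz |Q| ‖b‖ is at most the norm of the chart vector, with equality at x, where Q
  -- = 1. Hence 2 Re log Q + log ‖b‖² is a pluriharmonic function touching from below.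
  set Q : M → ℂ := fun y =>
    (((‖b‖ ^ 2 : ℝ) : ℂ)⁻¹ • (innerSL ℂ b).comp L) (chartAt E z₀ y - chartAt E z₀ z₀) with hQ
  have hQd : ∀ᶠ y in 𝓝 x, MDifferentiableAt 𝓘(ℂ, E) 𝓘(ℂ, ℂ) Q y := by
    filter_upwards [(chartAt E z₀).open_source.mem_nhds hx] with y hy
    exact mdifferentiableAt_clm_chartAt _ hy
  have hQx : Q x = 1 := by
    have : (inner ℂ b b : ℂ) = ((‖b‖ ^ 2 : ℝ) : ℂ) := by
      rw [inner_self_eq_norm_sq_to_K]; simp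
    simp only [hQ, smul_apply, ContinuousLinearMap.comp_apply,
      innerSL_apply_apply, ← hb, this, smul_eq_mul]
    exact inv_mul_cancel₀ (by exact_mod_cast (pow_pos hb0 2).ne')
  have hQs : ∀ᶠ y in 𝓝 x, Q y ∈ Complex.slitPlane :=
    hQd.self_of_nhds.continuousAt.eventually
      (by rw [hQx]; exact Complex.isOpen_slitPlane.mem_nhds Complex.one_mem_slitPlane)
  have h1 := IsPshAt.re_of_mdifferentiableAt (E := E) (x := x) (P := fun y => Complex.log (Q y)) (by
    filter_upwards [hQd, hQs] with y hy hys
    exact (Complex.differentiableAt_log hys).mdifferentiableAt.comp y hy)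
  have hc := eventually_continuousAt_chartNormSq L hx
  refine ((h1.const_mul zero_le_two).add (IsPshAt.const (Real.log (‖b‖ ^ 2)) x)).of_le ?_ ?_ ?_
  · filter_upwards [hc, hc.self_of_nhds.eventually_ne hne] with y hy hy0
    exact hy.log hy0
  · filter_upwards [hQs] with y hy
    set d : F := L (chartAt E z₀ y - chartAt E z₀ z₀) with hd
    have hq : ‖Q y‖ * ‖b‖ ≤ ‖d‖ := by
      have h3 : Q y = ((‖b‖ ^ 2 : ℝ) : ℂ)⁻¹ * inner ℂ b d := rfl
      have h4 := norm_inner_le_norm (𝕜 := ℂ) b d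
      rw [h3, norm_mul, norm_inv, Complex.norm_real, Real.norm_of_nonneg (by positivity)]
      calc (‖b‖ ^ 2)⁻¹ * ‖(inner ℂ b d : ℂ)‖ * ‖b‖
          ≤ (‖b‖ ^ 2)⁻¹ * (‖b‖ * ‖d‖) * ‖b‖ := by gcongr
        _ = ‖d‖ := by field_simp
    have hQ0 : 0 < ‖Q y‖ := norm_pos_iff.2 (Complex.slitPlane_ne_zero hy)
    rw [Complex.log_re]
    change 2 * Real.log ‖Q y‖ + Real.log (‖b‖ ^ 2) ≤ Real.log (‖d‖ ^ 2)
    rw [Real.log_pow, Real.log_pow]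
    have := Real.log_le_log (by positivity) hq
    rw [Real.log_mul hQ0.ne' hb0.ne'] at this
    push_cast
    linarith
  · simp only [hQx, chartNormSq, ← hb]
    simp

end Manifold

/-! ### The logarithmic dip. -/

/-- The function equal to `t` for `t ≥ s` and, for `t < s`, to the maximum of `-2` and of the
tangent `s * (1 + log (t / s))` to the identity with respect to the variable `log t`. -/
def logDip (s t : ℝ) : ℝ :=
  if t < s then
    s * (1 + (Real.log (max t (s * Real.exp (-1 - 2 / s))) - Real.log s)) else t

theorem logDip_of_lt {s t : ℝ} (h : t < s) : logDip s t =
    s * (1 + (Real.log (max t (s * Real.exp (-1 - 2 / s))) - Real.log s)) :=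
  if_pos h

theorem logDip_of_le {s t : ℝ} (h : s ≤ t) : logDip s t = t := if_neg (not_lt.2 h)

theorem logDip_zero {s : ℝ} (hs : 0 < s) : logDip s 0 = -2 := by
  -- The cutoff s * exp(-1 - 2 / s) is exactly where the tangent s * (1 + log (t / s)) takes the
  -- value -2.
  have h1 : 0 < s * Real.exp (-1 - 2 / s) := by positivity
  rw [logDip_of_lt hs, max_eq_right h1.le, Real.log_mul hs.ne' (Real.exp_pos _).ne', Real.log_exp]
  field_simp
  ring

theorem mul_exp_lt {s : ℝ} (hs : 0 < s) : s * Real.exp (-1 - 2 / s) < s := by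
  have : 0 < 2 / s := by positivity
  exact mul_lt_of_lt_one_right hs ((Real.exp_lt_exp.2 (by linarith)).trans_eq Real.exp_zero)

theorem mul_one_add_log_le {s t : ℝ} (hs : 0 < s) (ht : 0 < t) :
    s * (1 + (Real.log t - Real.log s)) ≤ t := by
  rw [← Real.log_div ht.ne' hs.ne']
  have := Real.log_le_sub_one_of_pos (div_pos ht hs)
  calc s * (1 + Real.log (t / s)) ≤ s * (t / s) := by gcongr; linarith
    _ = t := by field_simp

theorem logDip_le {s t : ℝ} (hs : 0 < s) (ht : 0 ≤ t) : logDip s t ≤ t := by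
  rcases lt_or_ge t s with h | h
  · rw [logDip_of_lt h]
    rcases le_total t (s * Real.exp (-1 - 2 / s)) with h1 | h1
    · have := logDip_zero hs
      rw [logDip_of_lt hs, max_eq_right (by positivity)] at this
      rw [max_eq_right h1, this]
      linarith
    · rw [max_eq_left h1]
      exact mul_one_add_log_le hs (lt_of_lt_of_le (by positivity) h1)
  · rw [logDip_of_le h]

theorem continuous_logDip {s : ℝ} (hs : 0 < s) : Continuous (logDip s) := by
  refine Continuous.if ?_ ?_ continuous_id
  · intro t ht
    change t ∈ frontier (Set.Iio s) at ht
    rw [frontier_Iio, Set.mem_singleton_iff] at ht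
    rw [ht, max_eq_left (mul_exp_lt hs).le]
    simp
  · have h1 : ∀ t, max t (s * Real.exp (-1 - 2 / s)) ≠ 0 := fun t =>
      (lt_of_lt_of_le (by positivity) (le_max_right t (s * Real.exp (-1 - 2 / s)))).ne'
    exact continuous_const.mul (continuous_const.add
      (((continuous_id.max continuous_const).log h1).sub continuous_const))

section Manifold

variable {E : Type*} [NormedAddCommGroup E] [NormedSpace ℂ E]
  {F : Type*} [NormedAddCommGroup F] [InnerProductSpace ℂ F]
  {M : Type*} [TopologicalSpace M] [ChartedSpace E M] [IsManifold 𝓘(ℂ, E) ω M]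

theorem isPshAt_logDip_chartNormSq (L : E →L[ℂ] F) {z₀ x : M} (hx : x ∈ (chartAt E z₀).source)
    {s : ℝ} (hs : 0 < s) : IsPshAt E (fun y => logDip s (chartNormSq L z₀ y)) x := by
  have hc := eventually_continuousAt_chartNormSq L hx
  have hcx := hc.self_of_nhds
  set σ : ℝ := s * Real.exp (-1 - 2 / s) with hσ
  have hσ0 : 0 < σ := by positivity
  rcases lt_trichotomy (chartNormSq L z₀ x) s with h | h | h
  · have hlog : IsPshAt E (fun y => Real.log (max (chartNormSq L z₀ y) σ)) x := by
      rcases lt_or_ge (chartNormSq L z₀ x) σ with h1 | h1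
      · refine (IsPshAt.const (Real.log σ) x).congr ?_
        filter_upwards [hcx.eventually (gt_mem_nhds h1)] with y hy
        rw [max_eq_right hy.le]
      · have h2 : 0 < chartNormSq L z₀ x := hσ0.trans_le h1
        refine ((isPshAt_log_chartNormSq L hx h2.ne').max (IsPshAt.const (Real.log σ) x)).congr ?_
        filter_upwards [hcx.eventually (lt_mem_nhds h2)] with y hy
        rcases le_total (chartNormSq L z₀ y) σ with h3 | h3
        · rw [max_eq_right h3, max_eq_right (Real.log_le_log hy h3)]
        · rw [max_eq_left h3, max_eq_left (Real.log_le_log hσ0 h3)]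
    refine (((IsPshAt.const 1 x).add (hlog.add (IsPshAt.const (-Real.log s) x))).const_mul
      hs.le).congr ?_
    filter_upwards [hcx.eventually (gt_mem_nhds h)] with y hy
    rw [logDip_of_lt hy, sub_eq_add_neg]
  -- At the kink the tangent, a plurisubharmonic function, touches both branches from below.
  · have h0 : 0 < chartNormSq L z₀ x := h ▸ hs
    refine (((IsPshAt.const 1 x).add ((isPshAt_log_chartNormSq L hx h0.ne').add
      (IsPshAt.const (-Real.log s) x))).const_mul hs.le).of_le ?_ ?_ ?_
    · filter_upwards [hc] with y hy
      exact (continuous_logDip hs).continuousAt.comp hy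
    · filter_upwards [hcx.eventually (lt_mem_nhds h0)] with y hy
      rw [← sub_eq_add_neg]
      rcases lt_or_ge (chartNormSq L z₀ y) s with h1 | h1
      · rw [logDip_of_lt h1]
        gcongr
        exact le_max_left _ _
      · rw [logDip_of_le h1]
        exact mul_one_add_log_le hs hy
    · rw [logDip_of_le h.ge, h]
      ring
  · refine (isPshAt_chartNormSq L hx).congr ?_
    filter_upwards [hcx.eventually (lt_mem_nhds h)] with y hy
    exact (logDip_of_le hy.le).symm

/-! ### Absence of isolated points. -/

/-- If near `z₀` a function of the class is the sum of `‖L (z - z₀)‖²` and of a function of the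
class, then `z₀` is not in the core. -/
theorem notMem_core_of_eventuallyEq [T2Space M] [FiniteDimensional ℂ E] (L : E ≃L[ℂ] F) {z₀ : M}
    {h w : M → ℝ} (hh : IsBoundedPsh E h) (hw : IsBoundedPsh E w)
    (heq : ∀ᶠ x in 𝓝 z₀, w x = chartNormSq (L : E →L[ℂ] F) z₀ x + h x) : z₀ ∉ core E M := by
  set q : M → ℝ := chartNormSq (L : E →L[ℂ] F) z₀ with hq
  have hosc : ∀ᶠ x in 𝓝 z₀, h z₀ - 1 < h x :=
    hh.continuous.continuousAt.eventually (lt_mem_nhds (by linarith))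
  obtain ⟨s, hs, hUc, hUN, hfr⟩ := exists_chartBall L (heq.eventually_nhds.and hosc)
  set U := chartBall (L : E →L[ℂ] F) z₀ s with hU
  have hUo : IsOpen U := isOpen_chartBall _ _ _
  have hzU : z₀ ∈ U := mem_chartBall_self _ _ hs
  classical
  set f : M → ℝ := fun x => if x ∈ U then logDip s (q x) + h x else w x with hf
  have hfin : ∀ x ∈ U, f x = logDip s (q x) + h x := fun x hx => if_pos hx
  have hfout : ∀ x ∉ U, f x = w x := fun x hx => if_neg hx
  have hfb : IsBoundedPsh E f := by
    refine ⟨fun x => ?_, ?_⟩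
    · by_cases hx : x ∈ closure U
      · obtain ⟨hxs, hxe, -⟩ := hUN hx
        -- Near the closure of U, w is q + h, and off U the dip is the identity; so both branches of
        -- f are given by the same formula.
        refine ((isPshAt_logDip_chartNormSq (L : E →L[ℂ] F) hxs hs).add (hh.isPshAt x)).congr ?_
        filter_upwards [hxe, (chartAt E z₀).open_source.mem_nhds hxs] with y hy hys
        by_cases hyU : y ∈ U
        · exact (hfin y hyU).symm
        · have : s ≤ q y := not_lt.1 fun h => hyU ⟨hys, h⟩
          rw [hfout y hyU, hy, logDip_of_le this]
      · refine (hw.isPshAt x).congr ?_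
        filter_upwards [isClosed_closure.isOpen_compl.mem_nhds hx] with y hy
        exact (hfout y fun h => hy (subset_closure h)).symm
    · obtain ⟨C, hC⟩ := hw.bddAbove
      refine ⟨C, fun x => ?_⟩
      by_cases hxU : x ∈ U
      · have h1 : w x = q x + h x := (hUN (subset_closure hxU)).2.1.self_of_nhds
        have h2 : logDip s (q x) ≤ q x := logDip_le hs (sq_nonneg _)
        rw [hfin x hxU]
        linarith [hC x]
      · rw [hfout x hxU]
        exact hC x
  have hq0 : q z₀ = 0 := chartNormSq_self _ _
  have hfz : f z₀ = h z₀ - 2 := by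
    rw [hfin z₀ hzU, hq0, logDip_zero hs]
    ring
  -- The constant h z₀ - 1 lies below h on the frontier, where f = q + h, and above f z₀ = h z₀ - 2.
  -- So q + (h z₀ - 1) loses on the frontier and wins near z₀.
  obtain ⟨g, g1, g2, -⟩ := IsBoundedPsh.glue hUo hUc (u := fun x => q x + (h z₀ - 1))
    (fun x hx => (isPshAt_chartNormSq (L : E →L[ℂ] F) (hUN hx).1).add (IsPshAt.const _ x)) hfb
    (fun x hx => by
      obtain ⟨hxs, hxe, hxo⟩ := hUN (frontier_subset_closure hx)
      have h1 : w x = q x + h x := hxe.self_of_nhds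
      rw [hUo.frontier_eq] at hx
      have h2 : h z₀ - 1 < h x := hxo
      rw [hfout x hx.2, h1]
      linarith)
  intro hcore
  refine hcore _ g1.coe_mem_PSHcb (smoothStrictlyPSHNear_of_eventuallyEq L (c := h z₀ - 1) ?_)
  have hqc : ContinuousAt q z₀ :=
    (eventually_continuousAt_chartNormSq (L : E →L[ℂ] F) (mem_chart_source E z₀)).self_of_nhds
  have hlt : f z₀ < q z₀ + (h z₀ - 1) := by rw [hfz, hq0]; linarith
  filter_upwards [hUo.mem_nhds hzU, hfb.continuous.continuousAt.eventually_lt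
    (hqc.add continuousAt_const) hlt] with x hx hx'
  rw [g2 x hx]
  exact max_eq_left hx'.le

theorem accPt_Acbe [T2Space M] [FiniteDimensional ℂ E] (L : E ≃L[ℂ] F)
    {w₀ : M} (hw₀ : w₀ ∈ core E M) {z₀ : M}
    (hz₀ : z₀ ∈ Acbe E w₀) : AccPt z₀ (Filter.principal (Acbe E w₀)) := by
  by_contra hacc
  rw [accPt_iff_frequently, Filter.not_frequently] at hacc
  obtain ⟨s, hs, hUc, hUN, hfr⟩ := exists_chartBall L hacc
  set U := chartBall (L : E →L[ℂ] F) z₀ s with hU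
  have hzU : z₀ ∈ U := mem_chartBall_self _ _ hs
  have hA : ∀ x ∈ Acbe E w₀, x ∈ closure U → x = z₀ := fun x hx hxU => by
    by_contra hne
    exact (hUN hxU).2 ⟨hne, hx⟩
  obtain ⟨hsub, h, w, hh, hw, heq⟩ := Acbe_subset_of_peak (isOpen_chartBall _ _ _) hUc
    (u := fun x => chartNormSq (L : E →L[ℂ] F) z₀ x + 1)
    (fun x hx => (isPshAt_chartNormSq (L : E →L[ℂ] F) (hUN hx).1).add (IsPshAt.const 1 x)) hz₀ hzU
    (by rw [chartNormSq_self]; norm_num)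
    -- Vacuous: a point of `Acbe E w₀` on the frontier would be z₀, where the squared norm is 0 and
    -- not s.
    (fun x hx => by
      have h1 := hA x hx.1 (frontier_subset_closure hx.2)
      have h2 := hfr x hx.2
      rw [h1, chartNormSq_self] at h2
      exact absurd h2 hs.ne)
  have hw₀A : w₀ ∈ Acbe E w₀ := fun _ _ => rfl
  have hwz : w₀ = z₀ := hA w₀ hw₀A (subset_closure (hsub hw₀A))
  subst hwz
  refine notMem_core_of_eventuallyEq L (hh.add (IsBoundedPsh.const 1)) hw ?_ hw₀
  filter_upwards [heq] with x hx
  rw [hx]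
  ring

end Manifold

end

theorem theorem4p5 {E : Type*} [NormedAddCommGroup E] [NormedSpace ℂ E] [FiniteDimensional ℂ E]
    {M : Type*} [TopologicalSpace M] [T2Space M] [SecondCountableTopology M]
    [ChartedSpace E M] [IsManifold 𝓘(ℂ, E) ω M]
    (w₀ : M) (hw₀ : w₀ ∈ core E M) :
    HasLocalMaximumProperty E (Acbe E w₀) := by
  -- The norm of E need not be smooth or Hermitian, so squared distances are measured in a Euclidean
  -- model.
  let L : E ≃L[ℂ] EuclideanSpace ℂ (Fin (Module.finrank ℂ E)) :=
    ContinuousLinearEquiv.ofFinrankEq (by simp)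
  refine ⟨⟨isClosed_Acbe w₀, fun z hz => accPt_Acbe L hw₀ hz⟩, fun z₀ _ => ?_⟩
  have : ProperSpace E := FiniteDimensional.proper ℂ E
  have : LocallyCompactSpace M := ChartedSpace.locallyCompactSpace E M
  obtain ⟨K, hK, hKs, hKc⟩ := local_compact_nhds
    ((chartAt E z₀).open_source.mem_nhds (mem_chart_source E z₀))
  have hcl : closure (interior K) ⊆ K := closure_minimal interior_subset hKc.isClosed
  refine ⟨interior K, isOpen_interior, mem_interior_iff_mem_nhds.2 hK,
    hKc.of_isClosed_subset isClosed_closure hcl, fun U hU _ hUc hUV hne u hu => ?_⟩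
  exact iSup_Acbe_closure_le isOpen_interior (interior_subset.trans hKs) hU hUc hUV hne hu
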